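/- Let $\kappa,\tau\in\mathbb R$. Put $\mathrm{sn}_\kappa(r)=\frac{1}{\sqrt\kappa}\sin(\sqrt\kappa r)$ for $\kappa>0$, $\mathrm{sn}_0(r)=r$, $\mathrm{sn}_\kappa(r)=\frac1{\sqrt{-\kappa}}\sinh(\sqrt{-\kappa}r)$ for $\kappa<0$, and $I_\kappa=(0,\pi/\sqrt\kappa)$ for $\kappa>0$, $I_\kappa=(0,\infty)$ for $\kappa\le 0$. Consider the homogeneous space $\mathbb E(\kappa,\tau)$ in geodesic polar coordinates $(r,\theta,z)$, $r\in I_\kappa$, $z\in\mathbb R$ (for $\kappa>0$: its fibrewise universal covering), with the metric $$g=dr^2+\mathrm{sn}_\kappa(r)^2\,d\theta^2+\bigl(4\tau\,\mathrm{sn}_\kappa(\tfrac r2)^2\,d\theta-dz\bigr)^2 .$$ For $a\in\mathbb R$ let $G_a$ be the group of screw motions $(r,\theta,z)\mapsto(r,\theta+\phi,z+a\phi)$, $\phi\in\mathbb R$, with orbit space $X_a=I_\kappa\times\mathbb R\ni(r,h)$, $h=z-a\theta$, carrying the quotient metric. A unit-speed curve $\gamma$ in $X_a$ (the profile curve) generates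 the $G_a$-invariant surface $\Sigma_\gamma=G_a(\gamma)$. For $H>0$ with $4H^2+\kappa>0$ let $\mathcal F_{a,H}$ be the family of all surfaces $\Sigma_\gamma$ of constant mean curvature $H$, where $\gamma:\mathbb R\to X_a$ is a smooth unit-speed curve and the mean curvature is the mean of the two principal curvatures, taken with respect to the unit normal $N$ for which $(\gamma',\partial_\theta+a\partial_z,N)$ is positively oriented in $(r,\theta,z)$. A tube is a surface in $\mathcal F_{a,H}$ whose profile curve is a simple loop, that is, periodic and injective on a period; so a tube is an immersed cylinder or torus. **Theorem (Existence of tubes).** Suppose $\kappa-4\tau^2\ne0$ and let $\epsilon=\operatorname{sgn}(\kappa-4\tau^2)$. Let $H>0$ with $4H^2+\kappa>0$. The family $\mathcal F_{a,H}$ contains a tube if 1. $\kappa\le 0$, $\;a\tau\epsilon\in\left(-\infty,\frac\epsilon2\right)$ and $H^2>\dfrac{2\tau^2-a\tau\kappa}{4a\tau-2}$, or 2. $\kappa>0$, $\;a\tau\epsilon\in\left[\frac{2\tau^2\epsilon}{\kappa},\frac\epsilon2\right)$ and $H^2>\dfrac{2\tau^2-a\tau\kappa}{4a\tau-2}$,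 or 3. $\kappa>0$, $\;a\tau\epsilon\in\left(\frac{4\tau^2\epsilon}{\kappa}-\frac\epsilon2,\frac{2\tau^2\epsilon}{\kappa}\right]$ and $H^2>\dfrac{2\tau^2-a\tau\kappa}{4a\tau+2-\frac{16\tau^2}{\kappa}}$. If $a\tau\epsilon$ is not contained in the interval in 1 (when $\kappa\le0$), respectively in either of the intervals in 2 and 3 (when $\kappa>0$), then $\mathcal F_{a,H}$ contains no tube for any $H>0$ with $4H^2+\kappa>0$. -/

import Mathlib

open scoped ContDiff

noncomputable section

namespace ScrewCMC

/-- The generalized sine `sn_κ`. -/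
def sn (κ r : ℝ) : ℝ :=
  if 0 < κ then Real.sin (√κ * r) / √κ
  else if κ = 0 then r
  else Real.sinh (√(-κ) * r) / √(-κ)

/-- The interval `I_κ` of admissible radii: `(0, π/√κ)` for `κ > 0` and `(0, ∞)` for `κ ≤ 0`. -/
def radii (κ : ℝ) : Set ℝ :=
  {r | 0 < r ∧ (0 < κ → r < Real.pi / √κ)}

/-- The metric of `𝔼(κ,τ)` in geodesic polar coordinates `p = (r, θ, z)`, applied to the tangent
vectors `u`, `v` at `p`:
`g = dr² + sn_κ(r)² dθ² + (4τ sn_κ(r/2)² dθ - dz)²`.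
The coordinate `θ` runs through `ℝ`; nothing depends on it, so that surfaces may be read
modulo `2π` in `θ`. -/
def metric (κ τ : ℝ) (p u v : Fin 3 → ℝ) : ℝ :=
  u 0 * v 0 + sn κ (p 0) ^ 2 * (u 1 * v 1)
    + (4 * τ * sn κ (p 0 / 2) ^ 2 * u 1 - u 2) * (4 * τ * sn κ (p 0 / 2) ^ 2 * v 1 - v 2)

/-- Christoffel symbols of the first kind of the metric: `g(∇_u v, w)` at `p` for coordinate-constant
vector fields `u`, `v`, `w`, where `∇` is the Levi-Civita connection (Koszul formula). -/
def christoffel (κ τ : ℝ) (p u v w : Fin 3 → ℝ) : ℝ :=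
  (lineDeriv ℝ (fun q => metric κ τ q v w) p u
    + lineDeriv ℝ (fun q => metric κ τ q u w) p v
    - lineDeriv ℝ (fun q => metric κ τ q u v) p w) / 2

/-- Partial derivative of a parametrized surface in its first parameter. -/
def d₁ (F : ℝ → ℝ → Fin 3 → ℝ) (s t : ℝ) : Fin 3 → ℝ := deriv (fun x => F x t) s

/-- Partial derivative of a parametrized surface in its second parameter. -/
def d₂ (F : ℝ → ℝ → Fin 3 → ℝ) (s t : ℝ) : Fin 3 → ℝ := deriv (fun y => F s y) t

/-- `N` is the unit normal at `F s t` for which `(∂₁F, ∂₂F, N)` is a positively oriented frame in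
the coordinates `(r, θ, z)`; in particular `F` is an immersion there. -/
structure IsUnitNormal (κ τ : ℝ) (F : ℝ → ℝ → Fin 3 → ℝ) (s t : ℝ) (N : Fin 3 → ℝ) : Prop where
  orthogonal_d₁ : metric κ τ (F s t) N (d₁ F s t) = 0
  orthogonal_d₂ : metric κ τ (F s t) N (d₂ F s t) = 0
  unit : metric κ τ (F s t) N N = 1
  oriented : 0 < Matrix.det !![d₁ F s t 0, d₁ F s t 1, d₁ F s t 2;
                               d₂ F s t 0, d₂ F s t 1, d₂ F s t 2;
                               N 0, N 1, N 2]

/-- The smooth immersed surface `F` has constant mean curvature `H` in `𝔼(κ,τ)`: twice `H` is the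
trace `(e G - 2 f M + g E) / (E G - M²)` of the second fundamental form `(e, f, g)` with respect to
the first fundamental form `(E, M, G)`. The second fundamental form is that of the positively
oriented unit normal, `II(∂ᵢ, ∂ⱼ) = g(∇_{∂ᵢF} ∂ⱼF, N)`. -/
def HasMeanCurvature (κ τ : ℝ) (F : ℝ → ℝ → Fin 3 → ℝ) (H : ℝ) : Prop :=
  ∀ s t, ∃ N, IsUnitNormal κ τ F s t N ∧
    let p := F s t
    let X := d₁ F s t
    let Y := d₂ F s t
    let E := metric κ τ p X X
    let M := metric κ τ p X Y
    let G := metric κ τ p Y Y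
    let e := metric κ τ p (d₁ (d₁ F) s t) N + christoffel κ τ p X X N
    let f := metric κ τ p (d₁ (d₂ F) s t) N + christoffel κ τ p X Y N
    let g := metric κ τ p (d₂ (d₂ F) s t) N + christoffel κ τ p Y Y N
    e * G - 2 * f * M + g * E = 2 * H * (E * G - M ^ 2)

/-- The screw motion `L_{a,φ}` of pitch `a` by the angle `φ`. -/
def screw (a φ : ℝ) (p : Fin 3 → ℝ) : Fin 3 → ℝ := ![p 0, p 1 + φ, p 2 + a * φ]

/-- The Killing field `ξ_a = ∂_θ + a ∂_z` generating the screw motions of pitch `a`. -/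
def killing (a : ℝ) : Fin 3 → ℝ := ![0, 1, a]

/-- The part of the tangent vector `v` at `p` that is orthogonal to the screw motion orbit. -/
def horizontal (κ τ a : ℝ) (p v : Fin 3 → ℝ) : Fin 3 → ℝ :=
  v - (metric κ τ p v (killing a) / metric κ τ p (killing a) (killing a)) • killing a

/-- The slice `θ = 0` meets every screw motion orbit once. It represents the point `(r, h)` of the
orbit space `X_a(κ,τ) = 𝔼(κ,τ)/G_a`, where `h = z - aθ`, and likewise its tangent vectors. -/
def slice (x : ℝ × ℝ) : Fin 3 → ℝ := ![x.1, 0, x.2]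

/-- The quotient metric (as a quadratic form) on the orbit space `X_a(κ,τ) = I_κ × ℝ ∋ (r, h)`: the
squared length of the horizontal part of a representing vector. Explicitly it is
`dr² + sn_κ(r)² / (sn_κ(r)² + (4τ sn_κ(r/2)² - a)²) dh²`. -/
def orbitMetric (κ τ a : ℝ) (x v : ℝ × ℝ) : ℝ :=
  metric κ τ (slice x) (horizontal κ τ a (slice x) (slice v))
    (horizontal κ τ a (slice x) (slice v))

/-- The surface `Σ_γ = G_a(γ)` swept out by a curve `γ = (r, h)` of the orbit space under the screw
motions of pitch `a`. -/
def sweep (a : ℝ) (γ : ℝ → ℝ × ℝ) (t φ : ℝ) : Fin 3 → ℝ := screw a φ (slice (γ t))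

/-- The family `𝓕_{a,H}` of the screw motion invariant surfaces of pitch `a` and constant mean
curvature `H`, each given by its profile curve: a smooth unit-speed curve `γ : ℝ → X_a(κ,τ)` such
that `Σ_γ` has constant mean curvature `H`. -/
structure IsProfileCurve (κ τ a H : ℝ) (γ : ℝ → ℝ × ℝ) : Prop where
  smooth : ContDiff ℝ ∞ γ
  mem_radii : ∀ t, (γ t).1 ∈ radii κ
  unit_speed : ∀ t, orbitMetric κ τ a (γ t) (deriv γ t) = 1
  mean_curvature : HasMeanCurvature κ τ (sweep a γ) H

/-- The curve `γ` is a simple loop: it closes up and has no self-intersections on a period. -/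
def IsSimpleLoop (γ : ℝ → ℝ × ℝ) : Prop :=
  ∃ T > 0, Function.Periodic γ T ∧ Set.InjOn γ (Set.Ico 0 T)

/-- The family `𝓕_{a,H}` contains a tube, that is, a surface whose profile curve is a simple
loop. -/
def ContainsTube (κ τ a H : ℝ) : Prop :=
  ∃ γ, IsProfileCurve κ τ a H γ ∧ IsSimpleLoop γ

end ScrewCMC

end

/-! Let σ be the tangent angle of the profile curve, so r' = cos σ. Passing to the quotient, the
orbit-length terms cancel and constant mean curvature becomes σ' + sin σ · cs/sn = 2H, with no trace
of a or τ (`hasMeanCurvature_sweep_iff`). It has the first integral J = sn sin σ - 2H vs. If J is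
not in `nodoidal`, sin σ has constant sign, the height is strictly monotone and the curve cannot
close. If J is in `nodoidal`, σ increases strictly and sin σ determines r, so σ serves as parameter
and a loop exists for this J exactly when `drift` vanishes.

The sign of the drift comes from pairing σ with σ + π. The squared orbit length is quadratic in x =
vs, with leading coefficient -(κ - 4τ²) and linear coefficient 2(1 - 2aτ). Hence its difference at
the two paired values of x has a sign governed by their midpoint `mid`, compared with c = (1 -
2aτ)/(κ - 4τ²) (`orbitSq_sub`).

Midpoints are positive, and below 2/κ if κ > 0; so a c outside that range gives a drift of fixed
sign and no tube (`drift_ne_zero`). Otherwise the bound on H supplies values of J with all midpoints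
below c and with all midpoints above c, and the intermediate value theorem gives a zero of the drift
(`exists_drift_eq_zero`). The resulting curve is simple by its reflection symmetry
(`angle_eq_of_height_eq`). -/

noncomputable section

namespace ScrewCMC

/-! ### Generalized trigonometry and the coordinate x = vs -/

/-- The generalized cosine, the derivative of `sn κ`. -/
def cs (κ r : ℝ) : ℝ :=
  if 0 < κ then Real.cos (√κ * r)
  else if κ = 0 then 1
  else Real.cosh (√(-κ) * r)

/-- The primitive `2 sn_κ(r/2)²` of `sn κ`. -/
def vs (κ r : ℝ) : ℝ := 2 * sn κ (r / 2) ^ 2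

theorem hasDerivAt_sn (κ r : ℝ) : HasDerivAt (sn κ) (cs κ r) r := by
  unfold sn cs
  split_ifs with h1 h2
  · have h : √κ ≠ 0 := (Real.sqrt_pos.2 h1).ne'
    have := (((hasDerivAt_id r).const_mul √κ).sin).div_const √κ
    simpa [h] using this
  · exact hasDerivAt_id r
  · have h0 : 0 < -κ := neg_pos.2 (lt_of_le_of_ne (not_lt.1 h1) h2)
    have h : √(-κ) ≠ 0 := (Real.sqrt_pos.2 h0).ne'
    have := (((hasDerivAt_id r).const_mul √(-κ)).sinh).div_const √(-κ)
    simpa [h] using this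

theorem hasDerivAt_cs (κ r : ℝ) : HasDerivAt (cs κ) (-κ * sn κ r) r := by
  unfold sn cs
  split_ifs with h1 h2
  · have h : √κ ≠ 0 := (Real.sqrt_pos.2 h1).ne'
    have hs := Real.mul_self_sqrt h1.le
    have := (((hasDerivAt_id r).const_mul √κ).cos)
    refine this.congr_deriv ?_
    rw [id_eq, mul_div_assoc', eq_div_iff h]
    linear_combination -Real.sin (√κ * r) * hs
  · subst h2
    simpa using hasDerivAt_const r (1 : ℝ)
  · have h0 : 0 < -κ := neg_pos.2 (lt_of_le_of_ne (not_lt.1 h1) h2)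
    have h : √(-κ) ≠ 0 := (Real.sqrt_pos.2 h0).ne'
    have hs := Real.mul_self_sqrt h0.le
    have := (((hasDerivAt_id r).const_mul √(-κ)).cosh)
    refine this.congr_deriv ?_
    rw [id_eq, mul_div_assoc', eq_div_iff h]
    linear_combination Real.sinh (√(-κ) * r) * hs

theorem cs_half (κ r : ℝ) : cs κ r = 1 - κ * vs κ r := by
  unfold vs sn cs
  split_ifs with h1 h2
  · have h : √κ ≠ 0 := (Real.sqrt_pos.2 h1).ne'
    have hs := Real.sq_sqrt h1.le
    have e : √κ * r = 2 * (√κ * (r / 2)) := by ring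
    rw [e, Real.cos_two_mul, Real.cos_sq', div_pow, hs]
    field_simp
    ring
  · simp [h2]
  · have h0 : 0 < -κ := neg_pos.2 (lt_of_le_of_ne (not_lt.1 h1) h2)
    have hs := Real.sq_sqrt h0.le
    have e : √(-κ) * r = 2 * (√(-κ) * (r / 2)) := by ring
    rw [e, Real.cosh_two_mul, Real.cosh_sq, div_pow, hs]
    field_simp
    ring

theorem sn_half (κ r : ℝ) : sn κ r = 2 * (sn κ (r / 2) * cs κ (r / 2)) := by
  unfold sn cs
  split_ifs with h1 h2
  · have e : √κ * r = 2 * (√κ * (r / 2)) := by ring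
    rw [e, Real.sin_two_mul]
    ring
  · ring
  · have e : √(-κ) * r = 2 * (√(-κ) * (r / 2)) := by ring
    rw [e, Real.sinh_two_mul]
    ring

theorem cs_sq_add (κ r : ℝ) : cs κ r ^ 2 + κ * sn κ r ^ 2 = 1 := by
  unfold sn cs
  split_ifs with h1 h2
  · have h : √κ ≠ 0 := (Real.sqrt_pos.2 h1).ne'
    rw [div_pow, Real.sq_sqrt h1.le, mul_div_cancel₀ _ h1.ne']
    exact Real.cos_sq_add_sin_sq _
  · simp [h2]
  · have h0 : 0 < -κ := neg_pos.2 (lt_of_le_of_ne (not_lt.1 h1) h2)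
    have hne : κ ≠ 0 := h2
    rw [div_pow, Real.sq_sqrt h0.le, Real.cosh_sq]
    field_simp
    ring

/-- Together with `cs_half` this makes cs and sn² polynomial in x = vs, so the later geometry
becomes algebra in x. -/
theorem sn_sq (κ r : ℝ) : sn κ r ^ 2 = 2 * vs κ r - κ * vs κ r ^ 2 := by
  have h := cs_sq_add κ (r / 2)
  rw [sn_half, vs]
  linear_combination 4 * sn κ (r / 2) ^ 2 * h

theorem hasDerivAt_vs (κ r : ℝ) : HasDerivAt (vs κ) (sn κ r) r := by
  have h1 : HasDerivAt (fun y : ℝ => y / 2) (1 / 2) r := (hasDerivAt_id r).div_const 2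
  have h2 := (((hasDerivAt_sn κ (r / 2)).comp r h1).pow 2).const_mul 2
  refine h2.congr_deriv ?_
  rw [sn_half]
  simp only [Function.comp_apply]
  ring

theorem sn_pos {κ r : ℝ} (hr : r ∈ radii κ) : 0 < sn κ r := by
  obtain ⟨h0, hr⟩ := hr
  unfold sn
  split_ifs with h1 h2
  · have h : 0 < √κ := Real.sqrt_pos.2 h1
    have := hr h1
    rw [lt_div_iff₀ h] at this
    exact div_pos (Real.sin_pos_of_pos_of_lt_pi (by positivity) (by linarith)) h
  · exact h0
  · have h3 : 0 < -κ := neg_pos.2 (lt_of_le_of_ne (not_lt.1 h1) h2)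
    have h : 0 < √(-κ) := Real.sqrt_pos.2 h3
    exact div_pos (Real.sinh_pos_iff.2 (by positivity)) h

theorem half_mem_radii {κ r : ℝ} (hr : r ∈ radii κ) : r / 2 ∈ radii κ :=
  ⟨by linarith [hr.1], fun h => by linarith [hr.1, hr.2 h]⟩

theorem vs_pos {κ r : ℝ} (hr : r ∈ radii κ) : 0 < vs κ r :=
  mul_pos two_pos (pow_pos (sn_pos (half_mem_radii hr)) 2)

theorem mul_vs_lt_two {κ r : ℝ} (hr : r ∈ radii κ) : κ * vs κ r < 2 := by
  have h1 := vs_pos hr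
  have h2 : 0 < vs κ r * (2 - κ * vs κ r) := by
    have := pow_pos (sn_pos hr) 2
    rw [sn_sq] at this
    linarith
  linarith [(mul_pos_iff_of_pos_left h1).1 h2]

/-- The inverse of `vs κ` on `radii κ`. -/
def rad (κ x : ℝ) : ℝ :=
  if 0 < κ then 2 * (Real.arcsin (√(κ * x / 2)) / √κ)
  else if κ = 0 then 2 * √(x / 2)
  else 2 * (Real.arsinh (√(-κ * x / 2)) / √(-κ))

theorem vs_rad {κ x : ℝ} (hx : 0 < x) (hκ : κ * x < 2) : vs κ (rad κ x) = x := by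
  unfold vs sn rad
  split_ifs with h1 h2
  · have h : √κ ≠ 0 := (Real.sqrt_pos.2 h1).ne'
    have hs := Real.sq_sqrt h1.le
    have h3 : √(κ * x / 2) ≤ 1 := Real.sqrt_le_one.2 (by linarith)
    rw [mul_div_cancel_left₀ _ two_ne_zero, mul_div_cancel₀ _ h,
      Real.sin_arcsin (by linarith [Real.sqrt_nonneg (κ * x / 2)]) h3, div_pow, hs,
      Real.sq_sqrt (by positivity)]
    field_simp
  · rw [mul_div_cancel_left₀ _ two_ne_zero, Real.sq_sqrt (by positivity)]
    ring
  · have h0 : 0 < -κ := neg_pos.2 (lt_of_le_of_ne (not_lt.1 h1) h2)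
    have h : √(-κ) ≠ 0 := (Real.sqrt_pos.2 h0).ne'
    have hs := Real.sq_sqrt h0.le
    rw [mul_div_cancel_left₀ _ two_ne_zero, mul_div_cancel₀ _ h,
      Real.sinh_arsinh, div_pow, hs, Real.sq_sqrt (by positivity)]
    field_simp

theorem rad_mem {κ x : ℝ} (hx : 0 < x) (hκ : κ * x < 2) : rad κ x ∈ radii κ := by
  unfold rad
  refine ⟨?_, fun h1 => ?_⟩
  · split_ifs with h1 h2
    · have h : 0 < √κ := Real.sqrt_pos.2 h1
      have : 0 < Real.arcsin (√(κ * x / 2)) := Real.arcsin_pos.2 (Real.sqrt_pos.2 (by positivity))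
      positivity
    · positivity
    · have h0 : 0 < -κ := neg_pos.2 (lt_of_le_of_ne (not_lt.1 h1) h2)
      have h : 0 < √(-κ) := Real.sqrt_pos.2 h0
      have : 0 < Real.arsinh (√(-κ * x / 2)) :=
        Real.arsinh_pos_iff.2 (Real.sqrt_pos.2 (by positivity))
      positivity
  · rw [if_pos h1, ← mul_div_assoc]
    have h : 0 < √κ := Real.sqrt_pos.2 h1
    have : Real.arcsin (√(κ * x / 2)) < Real.pi / 2 :=
      Real.arcsin_lt_pi_div_two.2 ((Real.sqrt_lt' one_pos).2 (by linarith))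
    gcongr
    linarith

theorem continuousAt_rad {κ x : ℝ} : ContinuousAt (rad κ) x := by
  have : Continuous (rad κ) := by
    by_cases h1 : 0 < κ
    · unfold rad
      simp only [if_pos h1]
      exact continuous_const.mul
        ((Real.continuous_arcsin.comp (by fun_prop)).div_const _)
    · by_cases h2 : κ = 0
      · unfold rad
        simp only [if_neg h1, if_pos h2]
        fun_prop
      · unfold rad
        simp only [if_neg h1, if_neg h2]
        exact continuous_const.mul
          ((Real.continuous_arsinh.comp (by fun_prop)).div_const _)
  exact this.continuousAt

theorem hasDerivAt_rad {κ x : ℝ} (hx : 0 < x) (hκ : κ * x < 2) :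
    HasDerivAt (rad κ) (sn κ (rad κ x))⁻¹ x := by
  refine HasDerivAt.of_local_left_inverse continuousAt_rad (hasDerivAt_vs κ (rad κ x))
    (sn_pos (rad_mem hx hκ)).ne' ?_
  have h1 : ∀ᶠ y in nhds x, 0 < y := lt_mem_nhds hx
  have h2 : ∀ᶠ y in nhds x, κ * y < 2 :=
    (continuous_const.mul continuous_id).continuousAt.eventually (gt_mem_nhds hκ)
  filter_upwards [h1, h2] with y hy1 hy2 using vs_rad hy1 hy2

/-! ### The metric, its derivatives and the quotient metric -/

/-- The squared length of the Killing field `ξ_a` at radius `r`, as a function of `x = vs κ r`. -/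
def orbitSq (κ τ a x : ℝ) : ℝ := 2 * x - κ * x ^ 2 + (2 * τ * x - a) ^ 2

theorem orbitSq_vs (κ τ a r : ℝ) :
    orbitSq κ τ a (vs κ r) = sn κ r ^ 2 + (2 * τ * vs κ r - a) ^ 2 := by
  rw [orbitSq, sn_sq]

theorem orbitSq_pos {κ τ a x : ℝ} (hx : 0 < x) (hκ : κ * x < 2) : 0 < orbitSq κ τ a x := by
  have : 0 < x * (2 - κ * x) := mul_pos hx (by linarith)
  unfold orbitSq
  nlinarith [sq_nonneg (2 * τ * x - a)]

theorem metric_eq (κ τ : ℝ) (p u v : Fin 3 → ℝ) :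
    metric κ τ p u v = u 0 * v 0 + sn κ (p 0) ^ 2 * (u 1 * v 1)
      + (2 * τ * vs κ (p 0) * u 1 - u 2) * (2 * τ * vs κ (p 0) * v 1 - v 2) := by
  unfold metric vs
  ring

theorem lineDeriv_metric (κ τ : ℝ) (p u v w : Fin 3 → ℝ) :
    lineDeriv ℝ (fun q => metric κ τ q v w) p u =
      u 0 * (2 * sn κ (p 0) * cs κ (p 0) * (v 1 * w 1)
        + 2 * τ * sn κ (p 0) * v 1 * (2 * τ * vs κ (p 0) * w 1 - w 2)
        + (2 * τ * vs κ (p 0) * v 1 - v 2) * (2 * τ * sn κ (p 0) * w 1)) := by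
  have h0 : HasDerivAt (fun t : ℝ => p 0 + t * u 0) (u 0) 0 := by
    simpa using ((hasDerivAt_id (0 : ℝ)).mul_const (u 0)).const_add (p 0)
  have e : p 0 = p 0 + 0 * u 0 := by ring
  have hs : HasDerivAt (fun t : ℝ => sn κ (p 0 + t * u 0)) (cs κ (p 0) * u 0) 0 :=
    HasDerivAt.comp (h := fun t : ℝ => p 0 + t * u 0) (h₂ := sn κ) 0
      (by rw [← e]; exact hasDerivAt_sn κ (p 0)) h0
  have hv : HasDerivAt (fun t : ℝ => vs κ (p 0 + t * u 0)) (sn κ (p 0) * u 0) 0 :=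
    HasDerivAt.comp (h := fun t : ℝ => p 0 + t * u 0) (h₂ := vs κ) 0
      (by rw [← e]; exact hasDerivAt_vs κ (p 0)) h0
  have hm : ∀ b c : ℝ, HasDerivAt (fun t : ℝ => 2 * τ * vs κ (p 0 + t * u 0) * b - c)
      (2 * τ * (sn κ (p 0) * u 0) * b) 0 := fun b c =>
    ((hv.const_mul (2 * τ)).mul_const b).sub_const c
  have key := ((hs.pow 2).mul_const (v 1 * w 1)).add ((hm (v 1) (v 2)).mul (hm (w 1) (w 2)))
  have key2 := key.const_add (v 0 * w 0)
  unfold lineDeriv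
  have ef : (fun t : ℝ => metric κ τ (p + t • u) v w) = fun t : ℝ => v 0 * w 0 +
      ((sn κ (p 0 + t * u 0)) ^ 2 * (v 1 * w 1) +
        (2 * τ * vs κ (p 0 + t * u 0) * v 1 - v 2) * (2 * τ * vs κ (p 0 + t * u 0) * w 1 - w 2)) := by
    funext t
    rw [metric_eq]
    simp only [Pi.add_apply, Pi.smul_apply, smul_eq_mul]
    ring
  rw [ef]
  refine (HasDerivAt.deriv key2).trans ?_
  rw [← e]
  push_cast
  ring

theorem orbitMetric_eq {κ τ a : ℝ} {x v : ℝ × ℝ} (hx : x.1 ∈ radii κ) :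
    orbitMetric κ τ a x v =
      v.1 ^ 2 + sn κ x.1 ^ 2 * v.2 ^ 2 / orbitSq κ τ a (vs κ x.1) := by
  have hs := sn_pos hx
  have hρ : sn κ x.1 ^ 2 + (2 * τ * vs κ x.1 - a) ^ 2 ≠ 0 := by positivity
  unfold orbitMetric horizontal
  simp only [metric_eq, slice, killing, Pi.sub_apply, Pi.smul_apply, smul_eq_mul,
    Matrix.cons_val_zero, Matrix.cons_val_one, Matrix.cons_val, orbitSq_vs]
  have hρ' : sn κ x.1 ^ 2 * (1 * 1) + (2 * τ * vs κ x.1 - a) * (2 * τ * vs κ x.1 - a) ≠ 0 := by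
    convert hρ using 1
    ring
  field_simp
  ring

/-! ### Mean curvature of a swept surface -/

theorem sweep_apply (a : ℝ) (γ : ℝ → ℝ × ℝ) (t φ : ℝ) :
    sweep a γ t φ = ![(γ t).1, φ, (γ t).2 + a * φ] := by
  simp [sweep, screw, slice]

theorem hasDerivAt_vec {f g k : ℝ → ℝ} {f' g' k' t : ℝ} (hf : HasDerivAt f f' t)
    (hg : HasDerivAt g g' t) (hk : HasDerivAt k k' t) :
    HasDerivAt (fun t => ![f t, g t, k t]) ![f', g', k'] t := by
  rw [hasDerivAt_pi]
  intro i
  fin_cases i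
  · exact hf
  · exact hg
  · exact hk

theorem d₁_sweep {a : ℝ} {r h r₁ h₁ : ℝ → ℝ} (hr : ∀ t, HasDerivAt r (r₁ t) t)
    (hh : ∀ t, HasDerivAt h (h₁ t) t) :
    d₁ (sweep a fun t => (r t, h t)) = fun t _ => ![r₁ t, 0, h₁ t] := by
  funext t φ
  simp only [d₁, sweep_apply]
  exact (hasDerivAt_vec (hr t) (hasDerivAt_const t φ) ((hh t).add_const (a * φ))).deriv

theorem d₂_sweep {a : ℝ} {γ : ℝ → ℝ × ℝ} :
    d₂ (sweep a γ) = fun _ _ => ![0, 1, a] := by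
  funext t φ
  simp only [d₂, sweep_apply]
  refine (hasDerivAt_vec (hasDerivAt_const φ _) (hasDerivAt_id φ) ?_).deriv
  simpa using ((hasDerivAt_id φ).const_mul a).const_add ((γ t).2)

/-- The oriented unit normal of the swept surface, for a unit-speed profile curve with
`r' = P` and `h' = ρ Q / sn r`. -/
theorem isUnitNormal_iff {κ τ a P Q ρ : ℝ} {F : ℝ → ℝ → Fin 3 → ℝ} {t φ : ℝ}
    (hr : F t φ 0 ∈ radii κ) (hρ : 0 < ρ)
    (hρ2 : ρ ^ 2 = sn κ (F t φ 0) ^ 2 + (2 * τ * vs κ (F t φ 0) - a) ^ 2)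
    (hPQ : P ^ 2 + Q ^ 2 = 1) (h1 : d₁ F t φ = ![P, 0, ρ * Q / sn κ (F t φ 0)])
    (h2 : d₂ F t φ = ![0, 1, a]) (N : Fin 3 → ℝ) :
    IsUnitNormal κ τ F t φ N ↔
      N = ![-Q, (2 * τ * vs κ (F t φ 0) - a) * P / (sn κ (F t φ 0) * ρ),
        2 * τ * vs κ (F t φ 0) * ((2 * τ * vs κ (F t φ 0) - a) * P / (sn κ (F t φ 0) * ρ))
          + sn κ (F t φ 0) * P / ρ] := by
  have hs := sn_pos hr
  set s := sn κ (F t φ 0)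
  set m := 2 * τ * vs κ (F t φ 0) with hm
  constructor
  · rintro ⟨o1, o2, o3, o4⟩
    rw [metric_eq, h1] at o1
    rw [metric_eq, h2] at o2
    rw [metric_eq] at o3
    rw [h1, h2, Matrix.det_fin_three] at o4
    simp only [Matrix.cons_val_zero, Matrix.cons_val_one, Matrix.cons_val, Matrix.of_apply,
      Matrix.cons_val', ← hm] at o1 o2 o3 o4
    change N 0 * P + s ^ 2 * (N 1 * 0) + (m * N 1 - N 2) * (m * 0 - ρ * Q / s) = 0 at o1
    change N 0 * 0 + s ^ 2 * (N 1 * 1) + (m * N 1 - N 2) * (m * 1 - a) = 0 at o2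
    change N 0 * N 0 + s ^ 2 * (N 1 * N 1) + (m * N 1 - N 2) * (m * N 1 - N 2) = 1 at o3
    -- Orthogonality to the orbit confines N to a plane; (N 0, μ) are orthonormal coordinates there.
    obtain ⟨μ, hμ⟩ : ∃ μ, m * N 1 - N 2 = -(s / ρ) * μ :=
      ⟨-(ρ / s) * (m * N 1 - N 2), by field_simp⟩
    have e1 : N 1 = (m - a) * μ / (s * ρ) := by
      rw [hμ] at o2
      rw [eq_div_iff (by positivity)]
      field_simp at o2
      refine mul_left_cancel₀ hs.ne' ?_
      linear_combination o2
    have e2 : N 2 = m * N 1 + s / ρ * μ := by linear_combination -hμ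
    have e3 : N 0 * P + Q * μ = 0 := by
      rw [hμ] at o1
      field_simp at o1
      refine mul_left_cancel₀ hρ.ne' ?_
      linear_combination o1
    have e4 : N 0 ^ 2 + μ ^ 2 = 1 := by
      rw [hμ, e1] at o3
      field_simp at o3
      have : (N 0 ^ 2 + μ ^ 2 - 1) * ρ ^ 2 = 0 := by
        linear_combination o3 + μ ^ 2 * hρ2
      rcases mul_eq_zero.1 this with h | h
      · linear_combination h
      · exact absurd h (by positivity)
    -- Orthogonality to the profile direction makes (N 0, μ) a multiple k of (-Q, P); unit length
    -- gives k² = 1 and the orientation selects k = 1.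
    obtain ⟨k, hk⟩ : ∃ k, k = P * μ - Q * N 0 := ⟨_, rfl⟩
    have e5 : N 0 = -Q * k := by
      rw [hk]; linear_combination P * e3 - N 0 * hPQ
    have e6 : μ = P * k := by
      rw [hk]; linear_combination Q * e3 - μ * hPQ
    have e7 : k ^ 2 = 1 := by
      rw [e5, e6] at e4
      linear_combination e4 - k ^ 2 * hPQ
    have e8 : 0 < k := by
      rw [e2, e1, e5, e6] at o4
      have : 0 < k * (ρ / s) := by
        refine o4.trans_eq ?_
        field_simp
        linear_combination s * ((-P ^ 2 * k) * hρ2 + k * ρ ^ 2 * hPQ)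
      exact (mul_pos_iff_of_pos_right (by positivity)).1 this
    have e9 : k = 1 := by nlinarith
    rw [e9, mul_one] at e5 e6
    rw [e6] at e1 e2
    funext i
    fin_cases i
    · exact e5
    · exact e1
    · simp only [Fin.reduceFinMk, Matrix.cons_val]
      rw [e2, e1]
      ring
  · rintro rfl
    refine ⟨?_, ?_, ?_, ?_⟩
    · rw [metric_eq, h1]
      simp only [Matrix.cons_val_zero, Matrix.cons_val_one, Matrix.cons_val]
      change -Q * P + s ^ 2 * _ + (m * _ - (m * _ + _)) * (m * 0 - ρ * Q / s) = 0
      field_simp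
      ring
    · rw [metric_eq, h2]
      simp only [Matrix.cons_val_zero, Matrix.cons_val_one, Matrix.cons_val]
      change -Q * 0 + s ^ 2 * _ + (m * _ - (m * _ + _)) * (m * 1 - a) = 0
      field_simp
      ring
    · rw [metric_eq]
      simp only [Matrix.cons_val_zero, Matrix.cons_val_one, Matrix.cons_val]
      change -Q * -Q + s ^ 2 * _ + (m * _ - (m * _ + _)) * (m * _ - (m * _ + _)) = 1
      field_simp
      linear_combination s ^ 2 * (ρ ^ 2 * hPQ - P ^ 2 * hρ2)
    · rw [h1, h2, Matrix.det_fin_three]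
      simp only [Matrix.cons_val_zero, Matrix.cons_val_one, Matrix.cons_val, Matrix.of_apply,
        Matrix.cons_val']
      have : 0 < ρ / s := by positivity
      refine this.trans_eq ?_
      field_simp
      linear_combination s * (P ^ 2 * hρ2 - ρ ^ 2 * hPQ)

theorem hasDerivAt_sqrt_orbitSq {κ τ a : ℝ} {r : ℝ → ℝ} {r' t : ℝ} (hr : HasDerivAt r r' t)
    (hm : r t ∈ radii κ) :
    HasDerivAt (fun t => √(orbitSq κ τ a (vs κ (r t))))
      ((sn κ (r t) * cs κ (r t) + 2 * τ * sn κ (r t) * (2 * τ * vs κ (r t) - a)) * r'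
        / √(orbitSq κ τ a (vs κ (r t)))) t := by
  have h0 := orbitSq_pos (τ := τ) (a := a) (vs_pos hm) (mul_vs_lt_two hm)
  have hv := (hasDerivAt_vs κ (r t)).comp t hr
  have h1 := ((hv.const_mul 2).sub ((hv.pow 2).const_mul κ)).add
    (((hv.const_mul (2 * τ)).sub_const a).pow 2)
  have h2 : HasDerivAt (fun t => orbitSq κ τ a (vs κ (r t))) _ t := h1
  refine (h2.sqrt h0.ne').congr_deriv ?_
  have := (Real.sqrt_pos.2 h0).ne'
  rw [div_eq_div_iff (by positivity) this]
  simp only [Function.comp_apply]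
  rw [cs_half]
  push_cast
  ring

/-- With P = cos σ and Q = sin σ the left side is σ' + sin σ · cs/sn. Conceptually, the geodesic
curvature in dr² + (sn/ρ)² dh² is σ' + sin σ (log (sn/ρ))', and the orbits of length density ρ add
sin σ (log ρ)'; so ρ, and with it a and τ, cancels. -/
theorem hasMeanCurvature_sweep_iff {κ τ a H : ℝ} {r h P Q P' Q' : ℝ → ℝ}
    (hm : ∀ t, r t ∈ radii κ) (hr : ∀ t, HasDerivAt r (P t) t)
    (hh : ∀ t, HasDerivAt h (√(orbitSq κ τ a (vs κ (r t))) * Q t / sn κ (r t)) t)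
    (hP : ∀ t, HasDerivAt P (P' t) t) (hQ : ∀ t, HasDerivAt Q (Q' t) t)
    (hPQ : ∀ t, P t ^ 2 + Q t ^ 2 = 1) :
    HasMeanCurvature κ τ (sweep a fun t => (r t, h t)) H ↔
      ∀ t, P t * Q' t - Q t * P' t + Q t * cs κ (r t) / sn κ (r t) = 2 * H := by
  have e1 := d₁_sweep (a := a) hr hh
  have e2 := d₂_sweep (a := a) (γ := fun t => (r t, h t))
  have hρ : ∀ t, 0 < √(orbitSq κ τ a (vs κ (r t))) := fun t =>
    Real.sqrt_pos.2 (orbitSq_pos (vs_pos (hm t)) (mul_vs_lt_two (hm t)))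
  have hρ2 : ∀ t, √(orbitSq κ τ a (vs κ (r t))) ^ 2 =
      sn κ (r t) ^ 2 + (2 * τ * vs κ (r t) - a) ^ 2 := fun t => by
    rw [Real.sq_sqrt (orbitSq_pos (vs_pos (hm t)) (mul_vs_lt_two (hm t))).le, orbitSq_vs]
  have e0 : ∀ t φ, sweep a (fun t => (r t, h t)) t φ 0 = r t := fun t φ => by
    rw [sweep_apply]; rfl
  have hN : ∀ t φ N, IsUnitNormal κ τ (sweep a fun t => (r t, h t)) t φ N ↔ _ := fun t φ N =>
    isUnitNormal_iff (F := sweep a fun t => (r t, h t)) (t := t) (φ := φ) (a := a)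
      (by rw [e0]; exact hm t) (hρ t) (by rw [e0]; exact hρ2 t) (hPQ t)
      (by rw [e1, e0]) (by rw [e2]) N
  have hs := fun t => sn_pos (hm t)
  have e11 : ∀ t φ, d₁ (fun t (_ : ℝ) => ![P t, 0,
      √(orbitSq κ τ a (vs κ (r t))) * Q t / sn κ (r t)]) t φ = _ := fun t φ =>
    (hasDerivAt_vec (hP t) (hasDerivAt_const t 0)
      (((hasDerivAt_sqrt_orbitSq (hr t) (hm t)).mul (hQ t)).div
        ((hasDerivAt_sn κ (r t)).comp t (hr t)) (hs t).ne')).deriv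
  have e12 : ∀ t φ, d₁ (fun _ _ => ![0, 1, a]) t φ = 0 := fun t φ => by simp [d₁]
  have e22 : ∀ t φ, d₂ (fun _ _ => ![0, 1, a]) t φ = 0 := fun t φ => by simp [d₂]
  unfold HasMeanCurvature
  refine forall_congr' fun t => Iff.trans (b := ∀ _ : ℝ, P t * Q' t - Q t * P' t +
    Q t * cs κ (r t) / sn κ (r t) = 2 * H) (forall_congr' fun φ => ?_) (forall_const ℝ)
  simp only [hN, exists_eq_left, christoffel, lineDeriv_metric, e1, e2, e11, e12, e22]
  simp only [metric_eq, e0, Pi.zero_apply, Matrix.cons_val_zero, Matrix.cons_val_one,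
    Matrix.cons_val, Function.comp_apply, Pi.mul_apply]
  have h1 := hρ t
  have h2 := hρ2 t
  have h3 := hs t
  have h4 := hPQ t
  generalize √(orbitSq κ τ a (vs κ (r t))) = ρ at *
  generalize vs κ (r t) = x at *
  generalize sn κ (r t) = s at *
  generalize cs κ (r t) = c at *
  generalize P t = p at *
  generalize Q t = q at *
  generalize P' t = p' at *
  generalize Q' t = q' at *
  -- Unit speed in the quotient means E G - M² = ρ², so both sides carry the factor ρ².
  refine Iff.trans (Eq.congr (y₁ := ρ ^ 2 * (p * q' - q * p' + q * c / s)) (y₂ := ρ ^ 2 * (2 * H))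
    ?_ ?_) (mul_right_inj' (pow_pos h1 2).ne')
  · linear_combination (norm := skip) -(-p' * q + p * q' + (s * c + 2 * τ * s * (2 * τ * x - a)) *
      p ^ 2 * q / ρ ^ 2 - q * c * p ^ 2 / s - 2 * τ * (2 * τ * x - a) * p ^ 2 * q / s) * h2
      + q * c / s * (-2 * p ^ 2 * h2 + ρ ^ 2 * h4)
      - 2 * τ * (2 * τ * x - a) * q * p ^ 2 / s * h2
    field_simp
    ring
  · linear_combination (norm := skip) (-2 * H * p ^ 2) * h2 + 2 * H * ρ ^ 2 * h4
    field_simp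
    ring

/-! ### Curves of nodoid type: radius as a function of the tangent angle -/

/-- The values of the first integral `J = sn_κ(r) sin σ - 2 H vs_κ(r)` for which the profile curve
turns around (the curves of nodoid type). -/
def nodoidal (κ H : ℝ) : Set ℝ := {J | J < 0 ∧ 0 < 4 * H + κ * J}

/-- For a curve with first integral `J`, the product of `sn_κ(r)` and the derivative of the tangent
angle, as a function of the sine `q` of the tangent angle. -/
def turn (κ H J q : ℝ) : ℝ := √(q ^ 2 - 4 * H * J - κ * J ^ 2)

/-- For a curve with first integral `J`, the value of `vs_κ(r)` as a function of the sine `q` of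
the tangent angle. -/
def vsOf (κ H J q : ℝ) : ℝ := (q ^ 2 - 2 * H * J + q * turn κ H J q) / (4 * H ^ 2 + κ * q ^ 2)

/-- For a curve with first integral `J`, the value of `sn_κ(r)` as a function of the sine `q` of
the tangent angle. -/
def snOf (κ H J q : ℝ) : ℝ :=
  (2 * H * turn κ H J q + q * (2 * H + κ * J)) / (4 * H ^ 2 + κ * q ^ 2)

theorem denom_pos {κ H q : ℝ} (hH : 0 < H) (hω : 0 < 4 * H ^ 2 + κ) (hq : q ^ 2 ≤ 1) :
    0 < 4 * H ^ 2 + κ * q ^ 2 := by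
  rcases le_or_gt 0 κ with h | h
  · positivity
  · nlinarith

/-- The two inequalities defining `nodoidal` enter as -J(4H + κJ) > 0, which keeps the angular
velocity away from zero. -/
theorem turn_radicand_gt {κ H J : ℝ} (q : ℝ) (hJ : J ∈ nodoidal κ H) :
    q ^ 2 < q ^ 2 - 4 * H * J - κ * J ^ 2 := by
  have := mul_pos (neg_pos.2 hJ.1) hJ.2
  linarith

theorem turn_radicand_pos {κ H J : ℝ} (q : ℝ) (hJ : J ∈ nodoidal κ H) :
    0 < q ^ 2 - 4 * H * J - κ * J ^ 2 :=
  (sq_nonneg q).trans_lt (turn_radicand_gt q hJ)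

theorem turn_sq {κ H J : ℝ} (q : ℝ) (hJ : J ∈ nodoidal κ H) :
    turn κ H J q ^ 2 = q ^ 2 - 4 * H * J - κ * J ^ 2 :=
  Real.sq_sqrt (turn_radicand_pos q hJ).le

theorem turn_pos {κ H J : ℝ} (q : ℝ) (hJ : J ∈ nodoidal κ H) : 0 < turn κ H J q :=
  Real.sqrt_pos.2 (turn_radicand_pos q hJ)

theorem turn_neg (κ H J q : ℝ) : turn κ H J (-q) = turn κ H J q := by
  simp [turn]

/-- With D = `turn`, (q² - 2HJ)² - q²D² = J²(4H² + κq²) > 0, so the square root term cannot change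
the sign of the numerator. The next two lemmas rest on analogous identities with right sides (4H +
κJ)²(4H² + κq²) and -J(4H + κJ)(4H² + κq²). -/
theorem vsOf_pos {κ H J q : ℝ} (hH : 0 < H) (hω : 0 < 4 * H ^ 2 + κ) (hJ : J ∈ nodoidal κ H)
    (hq : q ^ 2 ≤ 1) :
    0 < vsOf κ H J q := by
  have hL := denom_pos hH hω hq
  refine div_pos ?_ hL
  have h1 : 0 < -(H * J) := by
    have := mul_pos hH (neg_pos.2 hJ.1)
    linarith
  have h2 : (q * turn κ H J q) ^ 2 < (q ^ 2 - 2 * H * J) ^ 2 := by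
    rw [mul_pow, turn_sq q hJ]
    have := mul_pos (pow_pos (neg_pos.2 hJ.1) 2) hL
    nlinarith
  have h3 := abs_lt_of_sq_lt_sq h2 (by nlinarith [sq_nonneg q])
  linarith [(abs_lt.1 h3).1]

theorem mul_vsOf_lt_two {κ H J q : ℝ} (hH : 0 < H) (hω : 0 < 4 * H ^ 2 + κ) (hJ : J ∈ nodoidal κ H)
    (hq : q ^ 2 ≤ 1) :
    κ * vsOf κ H J q < 2 := by
  have hL := denom_pos hH hω hq
  rcases le_or_gt κ 0 with h | h
  · nlinarith [vsOf_pos hH hω hJ hq]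
  · rw [vsOf, mul_div_assoc', div_lt_iff₀ hL]
    have h1 := mul_pos hH hJ.2
    have h2 : (κ * (q * turn κ H J q)) ^ 2 < (κ * q ^ 2 + 2 * (H * (4 * H + κ * J))) ^ 2 := by
      rw [mul_pow, mul_pow, turn_sq q hJ]
      have := mul_pos (pow_pos hJ.2 2) hL
      nlinarith
    have h3 := abs_lt_of_sq_lt_sq h2 (by positivity)
    linarith [(abs_lt.1 h3).2]

theorem snOf_pos {κ H J q : ℝ} (hH : 0 < H) (hω : 0 < 4 * H ^ 2 + κ) (hJ : J ∈ nodoidal κ H)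
    (hq : q ^ 2 ≤ 1) :
    0 < snOf κ H J q := by
  have hL := denom_pos hH hω hq
  refine div_pos ?_ hL
  have hD := turn_pos q hJ
  have h2 : (q * (2 * H + κ * J)) ^ 2 < (2 * H * turn κ H J q) ^ 2 := by
    rw [mul_pow, mul_pow, turn_sq q hJ]
    have := mul_pos (mul_pos (neg_pos.2 hJ.1) hJ.2) hL
    nlinarith
  have h3 := abs_lt_of_sq_lt_sq h2 (by positivity)
  linarith [(abs_lt.1 h3).1]

theorem vsOf_mul {κ H J q : ℝ} (hH : 0 < H) (hω : 0 < 4 * H ^ 2 + κ) (hq : q ^ 2 ≤ 1) :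
    vsOf κ H J q * (4 * H ^ 2 + κ * q ^ 2) =
    q ^ 2 - 2 * H * J + q * turn κ H J q :=
  div_mul_cancel₀ _ (denom_pos hH hω hq).ne'

theorem snOf_mul {κ H J q : ℝ} (hH : 0 < H) (hω : 0 < 4 * H ^ 2 + κ) (hq : q ^ 2 ≤ 1) :
    snOf κ H J q * (4 * H ^ 2 + κ * q ^ 2) =
    2 * H * turn κ H J q + q * (2 * H + κ * J) :=
  div_mul_cancel₀ _ (denom_pos hH hω hq).ne'

/-- `vsOf` and `snOf` solve the system of the line q s = J + 2H x and the conic s² = 2x - κx². This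
is the line; `snOf_sq` is the conic. Eliminating s leaves a quadratic in x with roots `vsOf` at q
and at -q. -/
theorem first_integral_snOf {κ H J q : ℝ} (hH : 0 < H) (hω : 0 < 4 * H ^ 2 + κ) (hq : q ^ 2 ≤ 1) :
    q * snOf κ H J q = J + 2 * H * vsOf κ H J q := by
  have hL := denom_pos hH hω hq
  have e1 := vsOf_mul (J := J) hH hω hq
  have e2 := snOf_mul (J := J) hH hω hq
  refine mul_right_cancel₀ hL.ne' ?_
  linear_combination q * e2 - 2 * H * e1

theorem turn_eq {κ H J q : ℝ} (hH : 0 < H) (hω : 0 < 4 * H ^ 2 + κ) (hq : q ^ 2 ≤ 1) :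
    turn κ H J q = 2 * H * snOf κ H J q - q * (1 - κ * vsOf κ H J q) := by
  have hL := denom_pos hH hω hq
  have e1 := vsOf_mul (J := J) hH hω hq
  have e2 := snOf_mul (J := J) hH hω hq
  refine mul_right_cancel₀ hL.ne' ?_
  linear_combination -2 * H * e2 - q * κ * e1

theorem snOf_sq {κ H J q : ℝ} (hH : 0 < H) (hω : 0 < 4 * H ^ 2 + κ) (hJ : J ∈ nodoidal κ H)
    (hq : q ^ 2 ≤ 1) :
    snOf κ H J q ^ 2 = 2 * vsOf κ H J q - κ * vsOf κ H J q ^ 2 := by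
  have hL := denom_pos hH hω hq
  have hD := turn_sq q hJ
  have e1 := vsOf_mul (J := J) hH hω hq
  have e2 := snOf_mul (J := J) hH hω hq
  refine mul_right_cancel₀ (pow_pos hL 2).ne' ?_
  linear_combination (snOf κ H J q * (4 * H ^ 2 + κ * q ^ 2) +
    (2 * H * turn κ H J q + q * (2 * H + κ * J))) * e2 - 2 * (4 * H ^ 2 + κ * q ^ 2) * e1 +
    κ * (vsOf κ H J q * (4 * H ^ 2 + κ * q ^ 2) + (q ^ 2 - 2 * H * J + q * turn κ H J q)) * e1 +
    (4 * H ^ 2 + κ * q ^ 2) * hD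

theorem hasDerivAt_vsOf {κ H J q : ℝ} (hH : 0 < H) (hω : 0 < 4 * H ^ 2 + κ) (hJ : J ∈ nodoidal κ H)
    (hq : q ^ 2 ≤ 1) :
    HasDerivAt (vsOf κ H J) (snOf κ H J q ^ 2 / turn κ H J q) q := by
  have hL := denom_pos hH hω hq
  have hD := turn_pos q hJ
  have hD2 := turn_sq q hJ
  have h1 : HasDerivAt (turn κ H J) (q / turn κ H J q) q := by
    refine ((((hasDerivAt_pow 2 q).sub_const (4 * H * J)).sub_const (κ * J ^ 2)).sqrt
      (turn_radicand_pos q hJ).ne').congr_deriv ?_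
    rw [turn]
    push_cast
    ring
  have h2 : HasDerivAt (vsOf κ H J) _ q :=
    (((hasDerivAt_pow 2 q).sub_const (2 * H * J)).add ((hasDerivAt_id q).mul h1)).div
      (((hasDerivAt_pow 2 q).const_mul κ).const_add (4 * H ^ 2)) hL.ne'
  refine h2.congr_deriv ?_
  have e2 := snOf_mul (J := J) hH hω hq
  simp only [Pi.add_apply, Pi.mul_apply, id_eq]
  push_cast
  generalize turn κ H J q = D at *
  rw [div_eq_div_iff (pow_pos hL 2).ne' hD.ne']
  have e3 : q / D * D = q := div_mul_cancel₀ _ hD.ne'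
  linear_combination (-(snOf κ H J q * (4 * H ^ 2 + κ * q ^ 2)) -
    (2 * H * D + q * (2 * H + κ * J))) * e2 + q * (4 * H ^ 2 + κ * q ^ 2) * e3
    - κ * q ^ 2 * hD2

theorem vsOf_sub {κ H J q : ℝ} (hH : 0 < H) (hω : 0 < 4 * H ^ 2 + κ) (hq : q ^ 2 ≤ 1) :
    vsOf κ H J q - vsOf κ H J (-q) =
    2 * (q * turn κ H J q) / (4 * H ^ 2 + κ * q ^ 2) := by
  have hL := denom_pos hH hω hq
  unfold vsOf
  rw [turn_neg, neg_sq]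
  field_simp
  ring

theorem vsOf_add {κ H J q : ℝ} (hH : 0 < H) (hω : 0 < 4 * H ^ 2 + κ) (hq : q ^ 2 ≤ 1) :
    vsOf κ H J q + vsOf κ H J (-q) =
    2 * ((q ^ 2 - 2 * H * J) / (4 * H ^ 2 + κ * q ^ 2)) := by
  have hL := denom_pos hH hω hq
  unfold vsOf
  rw [turn_neg, neg_sq]
  field_simp
  ring

/-- The tangent angle determines the radius. -/
theorem eq_turn_and_eq_vsOf {κ H J q s x : ℝ} (hH : 0 < H) (hω : 0 < 4 * H ^ 2 + κ)
    (hJ : J ∈ nodoidal κ H) (hq : q ^ 2 ≤ 1) (hs : 0 < s) (hx : 0 < x) (hκ : κ * x < 2)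
    (hsx : s ^ 2 = 2 * x - κ * x ^ 2) (hJs : q * s = J + 2 * H * x) :
    2 * H * s - q * (1 - κ * x) = turn κ H J q ∧ x = vsOf κ H J q := by
  have hL := denom_pos hH hω hq
  have h1 : 0 < 2 * H * s - q * (1 - κ * x) := by
    have h2 : 0 < s * (2 * H * s - q * (1 - κ * x)) := by
      have h3 : s * (2 * H * s - q * (1 - κ * x)) =
          -J * (2 - κ * x) / 2 + x * (4 * H + κ * J) / 2 := by
        linear_combination 2 * H * hsx - (1 - κ * x) * hJs
      rw [h3]
      have h4 := mul_pos (neg_pos.2 hJ.1) (sub_pos.2 hκ)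
      have h5 := mul_pos hx hJ.2
      linarith
    exact (mul_pos_iff_of_pos_left hs).1 h2
  have h2 : 2 * H * s - q * (1 - κ * x) = turn κ H J q := by
    refine (Real.sqrt_eq_iff_mul_self_eq_of_pos h1).2 ?_ |>.symm
    linear_combination (4 * H ^ 2 + κ * q ^ 2) * hsx
      + (-4 * H * (1 - κ * x) - κ * (q * s + J + 2 * H * x)) * hJs
  refine ⟨h2, ?_⟩
  rw [vsOf, ← h2, eq_div_iff hL.ne']
  linear_combination -2 * H * hJs

/-! ### The height gained in one turn and its sign -/

/-- For a curve with first integral `J`, the derivative of the height `h` with respect to the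
tangent angle `σ`. -/
def heightRate (κ τ a H J σ : ℝ) : ℝ :=
  √(orbitSq κ τ a (vsOf κ H J (Real.sin σ))) * Real.sin σ / turn κ H J (Real.sin σ)

/-- The increase of height of a profile curve with first integral `J` during one full turn of its
tangent. -/
def drift (κ τ a H J : ℝ) : ℝ := ∫ σ in (0 : ℝ)..(2 * Real.pi), heightRate κ τ a H J σ

theorem continuous_heightRate {κ H : ℝ} (τ a : ℝ) (hH : 0 < H) (hω : 0 < 4 * H ^ 2 + κ) :
    Continuous fun p : nodoidal κ H × ℝ => heightRate κ τ a H p.1 p.2 := by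
  have h1 : Continuous fun p : nodoidal κ H × ℝ => turn κ H p.1 (Real.sin p.2) := by
    unfold turn
    fun_prop
  have h2 : Continuous fun p : nodoidal κ H × ℝ => vsOf κ H p.1 (Real.sin p.2) := by
    unfold vsOf
    exact Continuous.div (by fun_prop) (by fun_prop) fun p =>
      (denom_pos hH hω (Real.sin_sq_le_one p.2)).ne'
  unfold heightRate orbitSq
  exact Continuous.div (by fun_prop) h1 fun p => (turn_pos _ p.1.2).ne'

theorem continuous_heightRate_right {κ H J : ℝ} (τ a : ℝ) (hH : 0 < H)
    (hω : 0 < 4 * H ^ 2 + κ) (hJ : J ∈ nodoidal κ H) : Continuous (heightRate κ τ a H J) :=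
  (continuous_heightRate τ a hH hω).comp
    (f := fun σ : ℝ => ((⟨J, hJ⟩ : nodoidal κ H), σ)) (by fun_prop)

theorem continuousOn_drift {κ H : ℝ} (τ a : ℝ) (hH : 0 < H) (hω : 0 < 4 * H ^ 2 + κ) :
    ContinuousOn (drift κ τ a H) (nodoidal κ H) := by
  rw [continuousOn_iff_continuous_domRestrict]
  exact intervalIntegral.continuous_parametric_intervalIntegral_of_continuous'
    (f := fun (J : nodoidal κ H) σ => heightRate κ τ a H J σ)
    (continuous_heightRate τ a hH hω) 0 (2 * Real.pi)

theorem drift_eq_integral {κ H J : ℝ} (τ a : ℝ) (hH : 0 < H) (hω : 0 < 4 * H ^ 2 + κ)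
    (hJ : J ∈ nodoidal κ H) :
    drift κ τ a H J = ∫ σ in (0 : ℝ)..Real.pi,
      (heightRate κ τ a H J σ + heightRate κ τ a H J (σ + Real.pi)) := by
  have hc := continuous_heightRate_right τ a hH hω hJ
  have h1 : ∫ σ in Real.pi..(2 * Real.pi), heightRate κ τ a H J σ =
      ∫ σ in (0 : ℝ)..Real.pi, heightRate κ τ a H J (σ + Real.pi) := by
    rw [intervalIntegral.integral_comp_add_right]
    congr 1 <;> ring
  rw [drift, ← intervalIntegral.integral_add_adjacent_intervals (b := Real.pi)
    (hc.intervalIntegrable _ _) (hc.intervalIntegrable _ _), h1]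
  exact (intervalIntegral.integral_add (hc.intervalIntegrable _ _)
      ((hc.comp (continuous_add_const _)).intervalIntegrable _ _)).symm

theorem heightRate_add_heightRate (κ τ a H J σ : ℝ) :
    heightRate κ τ a H J σ + heightRate κ τ a H J (σ + Real.pi) =
      (√(orbitSq κ τ a (vsOf κ H J (Real.sin σ))) -
        √(orbitSq κ τ a (vsOf κ H J (-Real.sin σ)))) *
          (Real.sin σ / turn κ H J (Real.sin σ)) := by
  simp only [heightRate, Real.sin_add_pi, turn_neg]
  ring

/-- A difference of values of a quadratic polynomial factors through the difference and the sum of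
its arguments, given by `vsOf_sub` and `vsOf_add`. -/
theorem orbitSq_sub {κ τ a H J q : ℝ} (hH : 0 < H) (hω : 0 < 4 * H ^ 2 + κ) (hq : q ^ 2 ≤ 1) :
    orbitSq κ τ a (vsOf κ H J q) - orbitSq κ τ a (vsOf κ H J (-q)) =
      2 * (q * turn κ H J q) / (4 * H ^ 2 + κ * q ^ 2) * (2 * ((1 - 2 * a * τ) -
        (κ - 4 * τ ^ 2) * ((q ^ 2 - 2 * H * J) / (4 * H ^ 2 + κ * q ^ 2)))) := by
  have h1 := vsOf_sub (J := J) hH hω hq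
  have h2 := vsOf_add (J := J) hH hω hq
  rw [← h1]
  unfold orbitSq
  linear_combination (-(κ - 4 * τ ^ 2)) * (vsOf κ H J q - vsOf κ H J (-q)) * h2

theorem orbitSq_vsOf_pos {κ H J q : ℝ} (τ a : ℝ) (hH : 0 < H) (hω : 0 < 4 * H ^ 2 + κ)
    (hJ : J ∈ nodoidal κ H) (hq : q ^ 2 ≤ 1) : 0 < orbitSq κ τ a (vsOf κ H J q) :=
  orbitSq_pos (vsOf_pos hH hω hJ hq) (mul_vsOf_lt_two hH hω hJ hq)

/-- Under the hypothesis the orbit at angle σ is longer than the one at σ + π for every σ in (0, π),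
so the folded integrand is positive. -/
theorem drift_pos {κ τ a H J : ℝ} (hH : 0 < H) (hω : 0 < 4 * H ^ 2 + κ) (hJ : J ∈ nodoidal κ H)
    (h : ∀ q, 0 < q → q ≤ 1 → (κ - 4 * τ ^ 2) *
      ((q ^ 2 - 2 * H * J) / (4 * H ^ 2 + κ * q ^ 2)) < 1 - 2 * a * τ) :
    0 < drift κ τ a H J := by
  have hc := continuous_heightRate_right τ a hH hω hJ
  rw [drift_eq_integral τ a hH hω hJ]
  refine intervalIntegral.intervalIntegral_pos_of_pos_on
    ((hc.add (hc.comp (continuous_add_const _))).intervalIntegrable _ _) (fun σ hσ => ?_)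
    Real.pi_pos
  have hq := Real.sin_pos_of_mem_Ioo hσ
  have hL := denom_pos hH hω (Real.sin_sq_le_one σ)
  have hD := turn_pos (Real.sin σ) hJ
  rw [heightRate_add_heightRate]
  refine mul_pos (sub_pos.2 (Real.sqrt_lt_sqrt ?_ (sub_pos.1 ?_))) (div_pos hq hD)
  · exact (orbitSq_vsOf_pos τ a hH hω hJ (by rw [neg_sq]; exact Real.sin_sq_le_one σ)).le
  · rw [orbitSq_sub hH hω (Real.sin_sq_le_one σ)]
    have := h _ hq (Real.sin_le_one σ)
    exact mul_pos (by positivity) (by linarith)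

theorem drift_neg {κ τ a H J : ℝ} (hH : 0 < H) (hω : 0 < 4 * H ^ 2 + κ) (hJ : J ∈ nodoidal κ H)
    (h : ∀ q, 0 < q → q ≤ 1 → 1 - 2 * a * τ < (κ - 4 * τ ^ 2) *
      ((q ^ 2 - 2 * H * J) / (4 * H ^ 2 + κ * q ^ 2))) :
    drift κ τ a H J < 0 := by
  have hc := continuous_heightRate_right τ a hH hω hJ
  rw [drift_eq_integral τ a hH hω hJ, ← neg_pos, ← intervalIntegral.integral_neg]
  refine intervalIntegral.intervalIntegral_pos_of_pos_on
    ((hc.add (hc.comp (continuous_add_const _))).neg.intervalIntegrable _ _) (fun σ hσ => ?_)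
    Real.pi_pos
  have hq := Real.sin_pos_of_mem_Ioo hσ
  have hL := denom_pos hH hω (Real.sin_sq_le_one σ)
  have hD := turn_pos (Real.sin σ) hJ
  rw [heightRate_add_heightRate, neg_pos]
  refine mul_neg_of_neg_of_pos (sub_neg.2 (Real.sqrt_lt_sqrt ?_ (sub_neg.1 ?_))) (div_pos hq hD)
  · exact (orbitSq_vsOf_pos τ a hH hω hJ (Real.sin_sq_le_one σ)).le
  · rw [orbitSq_sub hH hω (Real.sin_sq_le_one σ)]
    have := h _ hq (Real.sin_le_one σ)
    exact mul_neg_of_pos_of_neg (by positivity) (by linarith)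

theorem convex_nodoidal (κ H : ℝ) : Convex ℝ (nodoidal κ H) := by
  have h : nodoidal κ H = Set.Iio 0 ∩ {J | -(4 * H) < κ * J} := by
    ext J
    simp only [nodoidal, Set.mem_ofPred_eq, Set.mem_inter_iff, Set.mem_Iio]
    constructor <;> rintro ⟨h1, h2⟩ <;> exact ⟨h1, by linarith⟩
  rw [h]
  exact (convex_Iio 0).inter (convex_halfSpace_gt (IsLinearMap.isLinearMap_smul κ) _)

/-! ### Comparing midpoints with the threshold c -/

/-- The midpoint of the two values of `vs_κ(r)` with opposite tangent angle of sine `± q`. -/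
def mid (κ H J q : ℝ) : ℝ := (q ^ 2 - 2 * H * J) / (4 * H ^ 2 + κ * q ^ 2)

theorem mid_pos {κ H J q : ℝ} (hH : 0 < H) (hω : 0 < 4 * H ^ 2 + κ) (hJ : J ∈ nodoidal κ H)
    (hq : q ^ 2 ≤ 1) : 0 < mid κ H J q := by
  refine div_pos ?_ (denom_pos hH hω hq)
  have := mul_pos hH (neg_pos.2 hJ.1)
  nlinarith [sq_nonneg q]

/-- For κ > 0 this reflects the antipodal symmetry r ↦ π/√κ - r, which sends vs to 2/κ - vs. It
exchanges the two ends of the interval `nodoidal`. -/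
theorem mid_reflect {κ H J q : ℝ} (hκ : 0 < κ) (hH : 0 < H) :
    mid κ H (-(4 * H / κ) - J) q = 2 / κ - mid κ H J q := by
  have hL : 4 * H ^ 2 + κ * q ^ 2 ≠ 0 := by positivity
  unfold mid
  rw [div_sub_div _ _ hκ.ne' hL, div_eq_div_iff hL (mul_ne_zero hκ.ne' hL)]
  have : 4 * H / κ * κ = 4 * H := div_mul_cancel₀ _ hκ.ne'
  linear_combination 2 * H * (4 * H ^ 2 + κ * q ^ 2) * this

theorem reflect_mem_nodoidal {κ H J : ℝ} (hκ : 0 < κ) (hJ : J ∈ nodoidal κ H) :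
    -(4 * H / κ) - J ∈ nodoidal κ H := by
  have : κ * (4 * H / κ) = 4 * H := mul_div_cancel₀ _ hκ.ne'
  refine ⟨?_, ?_⟩
  · have h := hJ.2
    have : 0 < κ * (4 * H / κ + J) := by linarith
    linarith [(mul_pos_iff_of_pos_left hκ).1 this]
  · have := mul_pos hκ (neg_pos.2 hJ.1)
    linarith

theorem mid_lt_two_div {κ H J q : ℝ} (hκ : 0 < κ) (hH : 0 < H) (hω : 0 < 4 * H ^ 2 + κ)
    (hJ : J ∈ nodoidal κ H) (hq : q ^ 2 ≤ 1) : mid κ H J q < 2 / κ := by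
  have := mid_pos hH hω (reflect_mem_nodoidal hκ hJ) hq
  rw [mid_reflect hκ hH] at this
  linarith

/-- As J tends to 0 from below, the midpoints tend to q²/(4H² + κq²), which is at most 1/(4H² + κ) <
c. -/
theorem exists_mid_lt {κ H c : ℝ} (hH : 0 < H) (hω : 0 < 4 * H ^ 2 + κ)
    (hc : 1 < c * (4 * H ^ 2 + κ)) :
    ∃ J ∈ nodoidal κ H, ∀ q, 0 < q → q ≤ 1 → mid κ H J q < c := by
  -- For J = -j this makes the midpoint nondecreasing in q², so q = 1 is the worst case; it also
  -- gives 4H + κJ > 0.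
  have h1 : ∀ᶠ j in nhds (0 : ℝ), κ * j < 2 * H :=
    (continuous_const.mul continuous_id).continuousAt.eventually (gt_mem_nhds (by simpa using hH))
  have h2 : ∀ᶠ j in nhds (0 : ℝ), 1 + 2 * H * j < c * (4 * H ^ 2 + κ) :=
    (continuous_const.add (continuous_const.mul continuous_id)).continuousAt.eventually
      (gt_mem_nhds (by simpa using hc))
  obtain ⟨j, ⟨h1, h2⟩, h3⟩ := (((h1.and h2).filter_mono nhdsWithin_le_nhds).and
    (self_mem_nhdsWithin (s := Set.Ioi 0))).exists
  have h3 : 0 < j := h3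
  refine ⟨-j, ⟨by linarith, by linarith⟩, fun q hq0 hq1 => ?_⟩
  have hq : q ^ 2 ≤ 1 := by nlinarith
  have hL := denom_pos hH hω hq
  rw [mid, div_lt_iff₀ hL]
  refine lt_of_mul_lt_mul_right ?_ hω.le
  have h4 := mul_lt_mul_of_pos_right h2 hL
  have h5 := mul_nonneg (mul_nonneg (sub_nonneg.2 h1.le) hH.le) (sub_nonneg.2 hq)
  nlinarith

theorem exists_lt_mid {κ H c : ℝ} (hH : 0 < H) (hκ : κ ≤ 0) (hω : 0 < 4 * H ^ 2 + κ)
    (hc : 0 < c) : ∃ J ∈ nodoidal κ H, ∀ q, 0 < q → q ≤ 1 → c < mid κ H J q := by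
  -- The numerator of the midpoint becomes q² + 4H²c, while c times the denominator is at most 4H²c
  -- since κ ≤ 0.
  refine ⟨-(2 * H * c), ⟨by linarith [mul_pos hH hc], by nlinarith [mul_pos hH hc]⟩,
    fun q hq0 hq1 => ?_⟩
  have hq : q ^ 2 ≤ 1 := by nlinarith
  rw [mid, lt_div_iff₀ (denom_pos hH hω hq)]
  have h1 := pow_pos hq0 2
  have := mul_nonneg (mul_nonneg hc.le (neg_nonneg.2 hκ)) h1.le
  linarith

theorem exists_drift_eq_zero {κ τ a H c : ℝ} (hH : 0 < H) (hω : 0 < 4 * H ^ 2 + κ)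
    (hne : κ - 4 * τ ^ 2 ≠ 0) (hc : (κ - 4 * τ ^ 2) * c = 1 - 2 * a * τ)
    (h1 : ∃ J ∈ nodoidal κ H, ∀ q, 0 < q → q ≤ 1 → mid κ H J q < c)
    (h2 : ∃ J ∈ nodoidal κ H, ∀ q, 0 < q → q ≤ 1 → c < mid κ H J q) :
    ∃ J ∈ nodoidal κ H, drift κ τ a H J = 0 := by
  obtain ⟨J₁, hJ₁, h1⟩ := h1
  obtain ⟨J₂, hJ₂, h2⟩ := h2
  have hp := (convex_nodoidal κ H).isPreconnected
  have hd := continuousOn_drift τ a hH hω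
  rcases lt_or_gt_of_ne hne with h | h
  · have e1 : drift κ τ a H J₁ < 0 := drift_neg hH hω hJ₁ fun q hq0 hq1 => by
      rw [← hc]; exact mul_lt_mul_of_neg_left (h1 q hq0 hq1) h
    have e2 : 0 < drift κ τ a H J₂ := drift_pos hH hω hJ₂ fun q hq0 hq1 => by
      rw [← hc]; exact mul_lt_mul_of_neg_left (h2 q hq0 hq1) h
    exact hp.intermediate_value hJ₁ hJ₂ hd ⟨e1.le, e2.le⟩
  · have e1 : 0 < drift κ τ a H J₁ := drift_pos hH hω hJ₁ fun q hq0 hq1 => by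
      rw [← hc]; exact mul_lt_mul_of_pos_left (h1 q hq0 hq1) h
    have e2 : drift κ τ a H J₂ < 0 := drift_neg hH hω hJ₂ fun q hq0 hq1 => by
      rw [← hc]; exact mul_lt_mul_of_pos_left (h2 q hq0 hq1) h
    exact hp.intermediate_value hJ₂ hJ₁ hd ⟨e2.le, e1.le⟩

/-- All midpoints lie in (0, ∞), or in (0, 2/κ) when κ > 0, hence on one side of c. -/
theorem drift_ne_zero {κ τ a H J : ℝ} (hH : 0 < H) (hω : 0 < 4 * H ^ 2 + κ)
    (hJ : J ∈ nodoidal κ H) (hne : κ - 4 * τ ^ 2 ≠ 0) {c : ℝ}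
    (hc : (κ - 4 * τ ^ 2) * c = 1 - 2 * a * τ) (h : c ≤ 0 ∨ 0 < κ ∧ 2 / κ ≤ c) :
    drift κ τ a H J ≠ 0 := by
  have h' : (∀ q, 0 < q → q ≤ 1 → c < mid κ H J q) ∨ (∀ q, 0 < q → q ≤ 1 → mid κ H J q < c) := by
    rcases h with h | ⟨hκ, h⟩
    · exact Or.inl fun q hq0 hq1 => h.trans_lt (mid_pos hH hω hJ (by nlinarith))
    · exact Or.inr fun q hq0 hq1 =>
        (mid_lt_two_div hκ hH hω hJ (by nlinarith)).trans_le h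
  rcases lt_or_gt_of_ne hne with hδ | hδ <;> rcases h' with h | h
  · exact (drift_pos hH hω hJ fun q hq0 hq1 => by
      rw [← hc]; exact mul_lt_mul_of_neg_left (h q hq0 hq1) hδ).ne'
  · exact (drift_neg hH hω hJ fun q hq0 hq1 => by
      rw [← hc]; exact mul_lt_mul_of_neg_left (h q hq0 hq1) hδ).ne
  · exact (drift_neg hH hω hJ fun q hq0 hq1 => by
      rw [← hc]; exact mul_lt_mul_of_pos_left (h q hq0 hq1) hδ).ne
  · exact (drift_pos hH hω hJ fun q hq0 hq1 => by
      rw [← hc]; exact mul_lt_mul_of_pos_left (h q hq0 hq1) hδ).ne'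

/-! ### Autonomous equations on the line -/

/-- A solution of an autonomous equation with smooth right-hand side is smooth. -/
theorem contDiff_of_hasDerivAt {g σ : ℝ → ℝ} (hg : ContDiff ℝ ∞ g)
    (hσ : ∀ t, HasDerivAt σ (g (σ t)) t) : ContDiff ℝ ∞ σ := by
  have hd : deriv σ = g ∘ σ := funext fun t => (hσ t).deriv
  have hdiff : Differentiable ℝ σ := fun t => (hσ t).differentiableAt
  refine contDiff_infty.2 fun n => ?_
  induction n with
  | zero => exact contDiff_zero.2 hdiff.continuous
  | succ n ih =>
    push_cast
    rw [contDiff_succ_iff_deriv]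
    refine ⟨hdiff, by simp, ?_⟩
    rw [hd]
    exact (hg.of_le (mod_cast le_top)).comp ih

/-- The autonomous equation `σ' = 1 / f(σ)` with periodic positive `f`. -/
theorem exists_periodic_flow {f : ℝ → ℝ} {p : ℝ} (hf : Continuous f) (h0 : ∀ x, 0 < f x)
    (hp : 0 < p) (hper : Function.Periodic f p) (s₀ : ℝ) :
    ∃ (σ : ℝ → ℝ) (T : ℝ), 0 < T ∧ (∀ t, HasDerivAt σ (f (σ t))⁻¹ t) ∧
      (∀ t, σ (t + T) = σ t + p) ∧ σ 0 = s₀ := by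
  -- F is the time needed to reach x from s₀; the solution is its inverse.
  set F : ℝ → ℝ := fun x => ∫ y in s₀..x, f y with hF
  have hi : ∀ a b, IntervalIntegrable f MeasureTheory.volume a b := fun a b =>
    hf.intervalIntegrable a b
  have hFd : ∀ x, HasDerivAt F (f x) x := fun x => (hf.integral_hasStrictDerivAt s₀ x).hasDerivAt
  have hmono : StrictMono F := strictMono_of_deriv_pos fun x => by rw [(hFd x).deriv]; exact h0 x
  have hcont : Continuous F := continuous_iff_continuousAt.2 fun x => (hFd x).continuousAt
  set T := ∫ y in (0 : ℝ)..(0 + p), f y with hT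
  have hTpos : 0 < T := intervalIntegral.intervalIntegral_pos_of_pos (hi _ _) h0 (by linarith)
  have hFp : ∀ x, F (x + p) = F x + T := fun x => by
    rw [hT, hper.intervalIntegral_add_eq 0 x, hF]
    exact (intervalIntegral.integral_add_adjacent_intervals (hi _ _) (hi _ _)).symm
  have hFn : ∀ (n : ℕ) x, F (x + n * p) = F x + n * T := by
    intro n
    induction n with
    | zero => simp
    | succ n ih =>
      intro x
      have : x + ((n + 1 : ℕ) : ℝ) * p = (x + n * p) + p := by push_cast; ring
      rw [this, hFp, ih]
      push_cast
      ring
  have hF0 : F s₀ = 0 := intervalIntegral.integral_same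
  have hsurj : Function.Surjective F := by
    intro y
    obtain ⟨n, hn⟩ := exists_nat_gt (|y| / T)
    rw [div_lt_iff₀ hTpos] at hn
    have h1 : F (s₀ + n * p) = n * T := by rw [hFn, hF0, zero_add]
    have h2 : F (s₀ - n * p) = -(n * T) := by
      have := hFn n (s₀ - n * p)
      rw [sub_add_cancel, hF0] at this
      linarith
    have := intermediate_value_univ (s₀ - n * p) (s₀ + n * p) hcont
    rw [h1, h2] at this
    exact this ⟨by linarith [neg_abs_le y], by linarith [le_abs_self y]⟩
  set e := hmono.orderIsoOfSurjective F hsurj with he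
  have heF : ∀ x, e x = F x := fun x => rfl
  have hFs : ∀ t, F (e.symm t) = t := fun t => e.apply_symm_apply t
  refine ⟨e.symm, T, hTpos, fun t => ?_, fun t => ?_, ?_⟩
  · exact HasDerivAt.of_local_left_inverse e.symm.continuous.continuousAt (hFd _) (h0 _).ne'
      (Filter.Eventually.of_forall hFs)
  · apply hmono.injective
    rw [hFp, hFs, hFs]
  · apply hmono.injective
    rw [hFs, hF0]

/-! ### Symmetry of the height and absence of self-intersections -/

/-- The height along a profile curve as a function of its tangent angle. -/
def height (κ τ a H J σ : ℝ) : ℝ := ∫ s in (0 : ℝ)..σ, heightRate κ τ a H J s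

section

variable {κ τ a H J : ℝ}

theorem hasDerivAt_height (hH : 0 < H) (hω : 0 < 4 * H ^ 2 + κ) (hJ : J ∈ nodoidal κ H) (σ : ℝ) :
    HasDerivAt (height κ τ a H J) (heightRate κ τ a H J σ) σ :=
  ((continuous_heightRate_right τ a hH hω hJ).integral_hasStrictDerivAt 0 σ).hasDerivAt

theorem height_sub (hH : 0 < H) (hω : 0 < 4 * H ^ 2 + κ) (hJ : J ∈ nodoidal κ H) (σ σ' : ℝ) :
    height κ τ a H J σ' - height κ τ a H J σ = ∫ s in σ..σ', heightRate κ τ a H J s := by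
  have hi := fun b c : ℝ => (continuous_heightRate_right τ a hH hω hJ).intervalIntegrable
    (μ := MeasureTheory.volume) b c
  exact intervalIntegral.integral_interval_sub_left (hi _ _) (hi _ _)

theorem heightRate_periodic : Function.Periodic (heightRate κ τ a H J) (2 * Real.pi) := fun σ => by
  simp only [heightRate, Real.sin_add_two_pi]

theorem height_add_two_pi (hH : 0 < H) (hω : 0 < 4 * H ^ 2 + κ) (hJ : J ∈ nodoidal κ H) (σ : ℝ) :
    height κ τ a H J (σ + 2 * Real.pi) = height κ τ a H J σ + drift κ τ a H J := by
  have h := height_sub (τ := τ) (a := a) hH hω hJ σ (σ + 2 * Real.pi)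
  rw [heightRate_periodic.intervalIntegral_add_eq σ 0, zero_add] at h
  rw [drift, ← h]
  ring

theorem height_add_nat_mul (hH : 0 < H) (hω : 0 < 4 * H ^ 2 + κ) (hJ : J ∈ nodoidal κ H)
    (n : ℕ) (σ : ℝ) : height κ τ a H J (σ + n * (2 * Real.pi)) =
      height κ τ a H J σ + n * drift κ τ a H J := by
  induction n with
  | zero => simp
  | succ n ih =>
    have : σ + ((n + 1 : ℕ) : ℝ) * (2 * Real.pi) = (σ + n * (2 * Real.pi)) + 2 * Real.pi := by
      push_cast; ring
    rw [this, height_add_two_pi hH hω hJ, ih]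
    push_cast
    ring

theorem heightRate_pi_sub (σ : ℝ) :
    heightRate κ τ a H J (Real.pi - σ) = heightRate κ τ a H J σ := by
  simp only [heightRate, Real.sin_pi_sub]

theorem heightRate_pos (hH : 0 < H) (hω : 0 < 4 * H ^ 2 + κ) (hJ : J ∈ nodoidal κ H) {σ : ℝ}
    (hσ : 0 < Real.sin σ) : 0 < heightRate κ τ a H J σ :=
  div_pos (mul_pos (Real.sqrt_pos.2 (orbitSq_vsOf_pos τ a hH hω hJ (Real.sin_sq_le_one σ))) hσ)
    (turn_pos _ hJ)

theorem heightRate_neg (hH : 0 < H) (hω : 0 < 4 * H ^ 2 + κ) (hJ : J ∈ nodoidal κ H) {σ : ℝ}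
    (hσ : Real.sin σ < 0) : heightRate κ τ a H J σ < 0 :=
  div_neg_of_neg_of_pos (mul_neg_of_pos_of_neg
    (Real.sqrt_pos.2 (orbitSq_vsOf_pos τ a hH hω hJ (Real.sin_sq_le_one σ))) hσ) (turn_pos _ hJ)

/-- The rate is invariant under σ ↦ π - σ, so the height is odd about σ = π/2 up to a constant. -/
theorem height_sub_reflect (hH : 0 < H) (hω : 0 < 4 * H ^ 2 + κ) (hJ : J ∈ nodoidal κ H)
    (σ : ℝ) : height κ τ a H J σ - height κ τ a H J (Real.pi - σ) =
      2 * (height κ τ a H J σ - height κ τ a H J (Real.pi / 2)) := by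
  have h : height κ τ a H J (Real.pi / 2) - height κ τ a H J (Real.pi - σ) =
      height κ τ a H J σ - height κ τ a H J (Real.pi / 2) := by
    rw [height_sub hH hω hJ, height_sub hH hω hJ]
    have := intervalIntegral.integral_comp_sub_left (a := Real.pi / 2) (b := σ)
      (heightRate κ τ a H J) Real.pi
    simp only [heightRate_pi_sub] at this
    rw [this]
    congr 1
    ring
  linarith

/-- The height rises on (π/2, π) and falls on (π, 3π/2); zero drift and the reflection make its
values at both ends equal. -/
theorem height_lt (hH : 0 < H) (hω : 0 < 4 * H ^ 2 + κ) (hJ : J ∈ nodoidal κ H)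
    (hd : drift κ τ a H J = 0) {σ : ℝ} (h1 : Real.pi / 2 < σ) (h2 : σ < 3 * Real.pi / 2) :
    height κ τ a H J (Real.pi / 2) < height κ τ a H J σ := by
  have hi := fun b c : ℝ => (continuous_heightRate_right τ a hH hω hJ).intervalIntegrable
    (μ := MeasureTheory.volume) b c
  rcases le_or_gt σ Real.pi with h | h
  · rw [← sub_pos, height_sub hH hω hJ]
    refine intervalIntegral.intervalIntegral_pos_of_pos_on (hi _ _) (fun x hx => ?_) h1
    exact heightRate_pos hH hω hJ (Real.sin_pos_of_pos_of_lt_pi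
      (by linarith [hx.1, Real.pi_pos]) (by linarith [hx.2]))
  · have e1 : height κ τ a H J (3 * Real.pi / 2) = height κ τ a H J (Real.pi / 2) := by
      have e2 := height_sub_reflect (τ := τ) (a := a) hH hω hJ (3 * Real.pi / 2)
      have e3 := height_add_two_pi (τ := τ) (a := a) hH hω hJ (Real.pi - 3 * Real.pi / 2)
      have e4 : Real.pi - 3 * Real.pi / 2 + 2 * Real.pi = 3 * Real.pi / 2 := by ring
      rw [e4, hd] at e3
      linarith
    rw [← e1, ← sub_pos, height_sub hH hω hJ, intervalIntegral.integral_symm,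
      ← intervalIntegral.integral_neg]
    refine intervalIntegral.intervalIntegral_pos_of_pos_on (hi _ _).neg (fun x hx => ?_) h2
    refine neg_pos.2 (heightRate_neg hH hω hJ ?_)
    have : Real.sin (x - Real.pi) = -Real.sin x := Real.sin_sub_pi x
    have h3 := Real.sin_pos_of_pos_of_lt_pi (x := x - Real.pi) (by linarith [hx.1])
      (by linarith [hx.2, Real.pi_pos])
    linarith

/-- Within one turn, equal sines leave only the mirror pair σ = π - σ' besides equality. Since then
σ' > π/2, `height_lt` and the reflection separate the two heights. -/
theorem angle_eq_of_height_eq (hH : 0 < H) (hω : 0 < 4 * H ^ 2 + κ) (hJ : J ∈ nodoidal κ H)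
    (hd : drift κ τ a H J = 0) {σ σ' : ℝ} (h1 : -(Real.pi / 2) ≤ σ) (h2 : σ' < 3 * Real.pi / 2)
    (hle : σ ≤ σ') (hsin : Real.sin σ = Real.sin σ')
    (hh : height κ τ a H J σ = height κ τ a H J σ') : σ = σ' := by
  by_contra hne
  have hlt := lt_of_le_of_ne hle hne
  have hπ := Real.pi_pos
  obtain ⟨k, hk | hk⟩ := Real.sin_eq_sin_iff.1 hsin
  · have h3 : (0 : ℝ) < 2 * k * Real.pi := by linarith
    have h4 : 2 * (k : ℝ) * Real.pi < 2 * Real.pi := by linarith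
    have h5 : (0 : ℝ) < k := by nlinarith
    have h6 : (k : ℝ) < 1 := by nlinarith
    norm_cast at h5 h6
    omega
  · have h3 : 2 * (k : ℝ) * Real.pi < 2 * Real.pi := by linarith
    have h4 : -(2 * Real.pi) < 2 * (k : ℝ) * Real.pi := by linarith
    have h5 : (k : ℝ) < 1 := by nlinarith
    have h6 : (-1 : ℝ) < k := by nlinarith
    norm_cast at h5 h6
    have h7 : k = 0 := by
      have : (-1 : ℤ) < k := by exact_mod_cast h6
      omega
    rw [h7] at hk
    have h8 : σ = Real.pi - σ' := by push_cast at hk; linarith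
    have h9 := height_sub_reflect (τ := τ) (a := a) hH hω hJ σ'
    have h10 := height_lt hH hω hJ hd (σ := σ') (by linarith) h2
    rw [← h8] at h9
    linarith

end

/-! ### From zero drift to a tube -/

theorem contDiff_turn_sin {κ H J : ℝ} (hJ : J ∈ nodoidal κ H) :
    ContDiff ℝ ∞ fun σ => turn κ H J (Real.sin σ) := by
  unfold turn
  exact ContDiff.sqrt (by fun_prop) fun σ => (turn_radicand_pos _ hJ).ne'

theorem contDiff_vsOf_sin {κ H J : ℝ} (hH : 0 < H) (hω : 0 < 4 * H ^ 2 + κ)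
    (hJ : J ∈ nodoidal κ H) : ContDiff ℝ ∞ fun σ => vsOf κ H J (Real.sin σ) := by
  have := contDiff_turn_sin hJ
  unfold vsOf
  exact ContDiff.div (by fun_prop) (by fun_prop) fun σ => (denom_pos hH hω (Real.sin_sq_le_one σ)).ne'

theorem contDiff_snOf_sin {κ H J : ℝ} (hH : 0 < H) (hω : 0 < 4 * H ^ 2 + κ)
    (hJ : J ∈ nodoidal κ H) : ContDiff ℝ ∞ fun σ => snOf κ H J (Real.sin σ) := by
  have := contDiff_turn_sin hJ
  unfold snOf
  exact ContDiff.div (by fun_prop) (by fun_prop) fun σ => (denom_pos hH hω (Real.sin_sq_le_one σ)).ne'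

theorem contDiff_heightRate {κ H J : ℝ} (τ a : ℝ) (hH : 0 < H) (hω : 0 < 4 * H ^ 2 + κ)
    (hJ : J ∈ nodoidal κ H) : ContDiff ℝ ∞ (heightRate κ τ a H J) := by
  have h1 := contDiff_turn_sin hJ
  have h2 := contDiff_vsOf_sin hH hω hJ
  have h3 : ContDiff ℝ ∞ fun σ => √(orbitSq κ τ a (vsOf κ H J (Real.sin σ))) := by
    refine ContDiff.sqrt ?_ fun σ => (orbitSq_vsOf_pos τ a hH hω hJ (Real.sin_sq_le_one σ)).ne'
    unfold orbitSq
    fun_prop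
  unfold heightRate
  exact (h3.mul Real.contDiff_sin).div h1 fun σ => (turn_pos _ hJ).ne'

theorem contDiff_of_hasDerivAt_contDiff {f f' : ℝ → ℝ} (h : ∀ t, HasDerivAt f (f' t) t)
    (hf' : ContDiff ℝ ∞ f') : ContDiff ℝ ∞ f := by
  rw [contDiff_infty_iff_deriv]
  refine ⟨fun t => (h t).differentiableAt, ?_⟩
  rwa [funext fun t => (h t).deriv]

theorem containsTube_of_drift_eq_zero {κ τ a H J : ℝ} (hH : 0 < H) (hω : 0 < 4 * H ^ 2 + κ)
    (hJ : J ∈ nodoidal κ H) (hd : drift κ τ a H J = 0) : ContainsTube κ τ a H := by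
  have hsn := fun σ => snOf_pos hH hω hJ (Real.sin_sq_le_one σ)
  have hD := fun σ => turn_pos (Real.sin σ) hJ
  have hX := fun σ => vsOf_pos hH hω hJ (Real.sin_sq_le_one σ)
  have hκX := fun σ => mul_vsOf_lt_two hH hω hJ (Real.sin_sq_le_one σ)
  have hπ := Real.pi_pos
  -- The time spent per unit of angle is `snOf / turn`. Starting at -π/2 makes one period cover
  -- [-π/2, 3π/2), the range of `angle_eq_of_height_eq`.
  obtain ⟨σ, T, hT, hσ, hσT, hσ0⟩ := exists_periodic_flow
    (f := fun σ => snOf κ H J (Real.sin σ) / turn κ H J (Real.sin σ)) (p := 2 * Real.pi)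
    ((contDiff_snOf_sin hH hω hJ).continuous.div (contDiff_turn_sin hJ).continuous
      fun σ => (hD σ).ne') (fun σ => div_pos (hsn σ) (hD σ)) (by positivity)
    (fun σ => by simp only [Real.sin_add_two_pi]) (-(Real.pi / 2))
  have hσ' : ∀ t, HasDerivAt σ (turn κ H J (Real.sin (σ t)) / snOf κ H J (Real.sin (σ t))) t :=
    fun t => (hσ t).congr_deriv (inv_div _ _)
  have hσs : ContDiff ℝ ∞ σ := contDiff_of_hasDerivAt
    ((contDiff_turn_sin hJ).div (contDiff_snOf_sin hH hω hJ) fun σ => (hsn σ).ne') hσ'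
  have hσm : StrictMono σ := strictMono_of_deriv_pos fun t => by
    rw [(hσ' t).deriv]; exact div_pos (hD _) (hsn _)
  set r : ℝ → ℝ := fun t => rad κ (vsOf κ H J (Real.sin (σ t))) with hr
  set h : ℝ → ℝ := fun t => height κ τ a H J (σ t) with hh
  have hrm : ∀ t, r t ∈ radii κ := fun t => rad_mem (hX _) (hκX _)
  have hvs : ∀ t, vs κ (r t) = vsOf κ H J (Real.sin (σ t)) := fun t => vs_rad (hX _) (hκX _)
  have hsr : ∀ t, sn κ (r t) = snOf κ H J (Real.sin (σ t)) := fun t => by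
    rw [← sq_eq_sq₀ (sn_pos (hrm t)).le (hsn _).le, sn_sq, hvs, snOf_sq hH hω hJ (Real.sin_sq_le_one _)]
  have hQd : ∀ t, HasDerivAt (fun t => Real.sin (σ t)) _ t := fun t => (hσ' t).sin
  have hPd : ∀ t, HasDerivAt (fun t => Real.cos (σ t)) _ t := fun t => (hσ' t).cos
  have hrd : ∀ t, HasDerivAt r (Real.cos (σ t)) t := fun t => by
    have h1 := (hasDerivAt_rad (hX (σ t)) (hκX (σ t))).comp t
      ((hasDerivAt_vsOf hH hω hJ (Real.sin_sq_le_one (σ t))).comp t (hQd t))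
    refine h1.congr_deriv ?_
    have h2 := hsr t
    have h3 := (hsn (σ t)).ne'
    have h4 := (hD (σ t)).ne'
    simp only [hr] at h2
    rw [h2]
    field_simp
  have hhd : ∀ t, HasDerivAt h (√(orbitSq κ τ a (vs κ (r t))) * Real.sin (σ t) / sn κ (r t)) t :=
    fun t => by
      refine ((hasDerivAt_height hH hω hJ (σ t)).comp t (hσ' t)).congr_deriv ?_
      rw [hvs, hsr, heightRate]
      have h3 := (hsn (σ t)).ne'
      have h4 := (hD (σ t)).ne'
      field_simp
  have hrs : ContDiff ℝ ∞ r :=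
    contDiff_of_hasDerivAt_contDiff hrd (Real.contDiff_cos.comp hσs)
  have hhs : ContDiff ℝ ∞ h := (contDiff_of_hasDerivAt_contDiff (hasDerivAt_height hH hω hJ)
    (contDiff_heightRate τ a hH hω hJ)).comp hσs
  refine ⟨fun t => (r t, h t), ⟨hrs.prodMk hhs, hrm, fun t => ?_, ?_⟩, T, hT, fun t => ?_, ?_⟩
  · rw [((hrd t).prodMk (hhd t)).deriv, orbitMetric_eq (hrm t)]
    have h0 := orbitSq_pos (τ := τ) (a := a) (vs_pos (hrm t)) (mul_vs_lt_two (hrm t))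
    have h1 := Real.sq_sqrt h0.le
    have h2 := (sn_pos (hrm t)).ne'
    dsimp only
    rw [div_pow, mul_pow, h1]
    field_simp
    exact Real.cos_sq_add_sin_sq _
  · rw [hasMeanCurvature_sweep_iff hrm hrd hhd hPd hQd fun t => Real.cos_sq_add_sin_sq _]
    intro t
    rw [hsr, cs_half, hvs]
    have h3 := (hsn (σ t)).ne'
    have h4 := turn_eq (J := J) hH hω (Real.sin_sq_le_one (σ t))
    have h5 := Real.cos_sq_add_sin_sq (σ t)
    field_simp
    linear_combination h4 + turn κ H J (Real.sin (σ t)) * h5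
  · simp only [hr, hh, hσT, Real.sin_add_two_pi, height_add_two_pi hH hω hJ, hd, add_zero]
  · have hmem : ∀ t ∈ Set.Ico 0 T, -(Real.pi / 2) ≤ σ t ∧ σ t < 3 * Real.pi / 2 := by
      intro t ht
      refine ⟨hσ0 ▸ hσm.monotone ht.1, (hσm ht.2).trans_eq ?_⟩
      have := hσT 0
      rw [zero_add, hσ0] at this
      rw [this]
      ring
    intro t ht t' ht' heq
    obtain ⟨e1, e2⟩ := Prod.mk.inj heq
    have e3 : vsOf κ H J (Real.sin (σ t)) = vsOf κ H J (Real.sin (σ t')) := by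
      rw [← hvs, ← hvs, e1]
    have e4 : snOf κ H J (Real.sin (σ t)) = snOf κ H J (Real.sin (σ t')) := by
      rw [← hsr, ← hsr, e1]
    -- Equal radii give equal sn and vs, so the first integral forces equal sines.
    have e5 : Real.sin (σ t) = Real.sin (σ t') := by
      have h1 := first_integral_snOf (J := J) hH hω (Real.sin_sq_le_one (σ t))
      have h2 := first_integral_snOf (J := J) hH hω (Real.sin_sq_le_one (σ t'))
      rw [e3, ← h2, e4] at h1
      exact mul_right_cancel₀ (hsn _).ne' h1
    apply hσm.injective
    rcases le_total (σ t) (σ t') with hle | hle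
    · exact angle_eq_of_height_eq hH hω hJ hd (hmem t ht).1 (hmem t' ht').2 hle e5 e2
    · exact (angle_eq_of_height_eq hH hω hJ hd (hmem t' ht').1 (hmem t ht).2 hle e5.symm
        e2.symm).symm

/-! ### From a tube to zero drift -/

theorem eq_of_hasDerivAt_zero {f : ℝ → ℝ} (hf : ∀ t, HasDerivAt f 0 t) (s t : ℝ) : f s = f t :=
  is_const_of_deriv_eq_zero (fun x => (hf x).differentiableAt) (fun x => (hf x).deriv) s t

/-- A differentiable unit circle valued curve with angular velocity `k` has an angle function. -/
theorem exists_angle {P Q k : ℝ → ℝ} (hk : Continuous k) (hP : ∀ t, HasDerivAt P (-Q t * k t) t)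
    (hQ : ∀ t, HasDerivAt Q (P t * k t) t) (hPQ : ∀ t, P t ^ 2 + Q t ^ 2 = 1) :
    ∃ σ : ℝ → ℝ, (∀ t, HasDerivAt σ (k t) t) ∧ ∀ t, P t = Real.cos (σ t) ∧ Q t = Real.sin (σ t) := by
  obtain ⟨σ₀, h1, h2⟩ : ∃ σ₀, Real.cos σ₀ = P 0 ∧ Real.sin σ₀ = Q 0 := by
    have hz : ‖(⟨P 0, Q 0⟩ : ℂ)‖ = 1 := by
      rw [Complex.norm_def, Complex.normSq_mk, Real.sqrt_eq_one]
      linarith [hPQ 0]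
    have hz0 : (⟨P 0, Q 0⟩ : ℂ) ≠ 0 := fun h => by simp [h] at hz
    exact ⟨Complex.arg ⟨P 0, Q 0⟩, by rw [Complex.cos_arg hz0, hz, div_one],
      by rw [Complex.sin_arg, hz, div_one]⟩
  set σ : ℝ → ℝ := fun t => σ₀ + ∫ s in (0 : ℝ)..t, k s with hσ
  have hσd : ∀ t, HasDerivAt σ (k t) t := fun t =>
    (hk.integral_hasStrictDerivAt 0 t).hasDerivAt.const_add σ₀
  have hσ0 : σ 0 = σ₀ := by simp [hσ]
  refine ⟨σ, hσd, fun t => ?_⟩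
  -- Both unit vectors rotate with angular velocity k, so their squared distance is constant, and it
  -- is zero at time 0.
  have hE : ∀ t, HasDerivAt
      (fun t => (P t - Real.cos (σ t)) ^ 2 + (Q t - Real.sin (σ t)) ^ 2) 0 t := fun t => by
    refine ((((hP t).sub (hσd t).cos).pow 2).add (((hQ t).sub (hσd t).sin).pow 2)).congr_deriv ?_
    simp only [Pi.sub_apply]
    push_cast
    ring
  have h3 := eq_of_hasDerivAt_zero hE t 0
  simp only [hσ0, h1, h2, sub_self] at h3
  have h4 := sq_nonneg (P t - Real.cos (σ t))
  have h5 := sq_nonneg (Q t - Real.sin (σ t))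
  have h6 : (P t - Real.cos (σ t)) ^ 2 = 0 := by linarith
  have h7 : (Q t - Real.sin (σ t)) ^ 2 = 0 := by linarith
  exact ⟨sub_eq_zero.1 (pow_eq_zero_iff two_ne_zero |>.1 h6),
    sub_eq_zero.1 (pow_eq_zero_iff two_ne_zero |>.1 h7)⟩

theorem periodic_deriv {f : ℝ → ℝ} {T : ℝ} (h : Function.Periodic f T) :
    Function.Periodic (deriv f) T := fun t => by
  rw [← deriv_comp_add_const, show (fun x => f (x + T)) = f from funext h]

/-- A periodic height excludes J outside `nodoidal`. Inside, the height differs from `height` of the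
angle by a constant, and over a period the angle grows by 2πn with n > 0, so n times the drift is
zero. -/
theorem exists_drift_eq_zero_of_containsTube {κ τ a H : ℝ} (hH : 0 < H)
    (hω : 0 < 4 * H ^ 2 + κ) (h : ContainsTube κ τ a H) :
    ∃ J ∈ nodoidal κ H, drift κ τ a H J = 0 := by
  obtain ⟨γ, ⟨hγ, hrm, hu, hmc⟩, T, hT, hper, -⟩ := h
  set r : ℝ → ℝ := fun t => (γ t).1 with hr
  set h : ℝ → ℝ := fun t => (γ t).2 with hh
  replace hrm : ∀ t, r t ∈ radii κ := hrm
  have hrs : ContDiff ℝ ∞ r := contDiff_fst.comp hγ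
  have hhs : ContDiff ℝ ∞ h := contDiff_snd.comp hγ
  have hrs' : ContDiff ℝ ∞ (deriv r) := (contDiff_infty_iff_deriv.1 hrs).2
  have hhs' : ContDiff ℝ ∞ (deriv h) := (contDiff_infty_iff_deriv.1 hhs).2
  have hdiff : ∀ {f : ℝ → ℝ}, ContDiff ℝ ∞ f → ∀ t, HasDerivAt f (deriv f t) t := fun hf t =>
    (hf.differentiable (by simp) t).hasDerivAt
  have hrd := hdiff hrs
  have hhd := hdiff hhs
  have hPd := hdiff hrs'
  have hsn : ∀ t, 0 < sn κ (r t) := fun t => sn_pos (hrm t)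
  have hρ : ∀ t, 0 < orbitSq κ τ a (vs κ (r t)) := fun t =>
    orbitSq_pos (vs_pos (hrm t)) (mul_vs_lt_two (hrm t))
  have hρ' := fun t => Real.sqrt_pos.2 (hρ t)
  set P := deriv r with hP
  set Q : ℝ → ℝ := fun t => sn κ (r t) * deriv h t / √(orbitSq κ τ a (vs κ (r t))) with hQ
  have hQdiff : ∀ t, HasDerivAt Q (deriv Q t) t := fun t =>
    ((((hasDerivAt_sn κ (r t)).comp t (hrd t)).mul (hdiff hhs' t)).div
      (hasDerivAt_sqrt_orbitSq (hrd t) (hrm t)) (hρ' t).ne').differentiableAt.hasDerivAt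
  have hhd' : ∀ t, HasDerivAt h (√(orbitSq κ τ a (vs κ (r t))) * Q t / sn κ (r t)) t := fun t => by
    refine (hhd t).congr_deriv ?_
    have h1 := (hρ' t).ne'
    have h2 := (hsn t).ne'
    simp only [hQ]
    field_simp
  have hPQ : ∀ t, P t ^ 2 + Q t ^ 2 = 1 := fun t => by
    have h1 := hu t
    rw [show deriv γ t = (P t, deriv h t) from ((hrd t).prodMk (hhd t)).deriv,
      orbitMetric_eq (hrm t)] at h1
    rw [← h1]
    simp only [hQ]
    rw [div_pow, mul_pow, Real.sq_sqrt (hρ t).le]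
  have hcurv := (hasMeanCurvature_sweep_iff (H := H) hrm hrd hhd' hPd hQdiff hPQ).1 hmc
  -- The angular velocity σ' dictated by the curvature equation.
  set k : ℝ → ℝ := fun t => 2 * H - Q t * cs κ (r t) / sn κ (r t) with hk
  have hPQ' : ∀ t, P t * deriv P t + Q t * deriv Q t = 0 := fun t => by
    have h1 := ((hPd t).pow 2).add ((hQdiff t).pow 2)
    have h2 : HasDerivAt (fun t => P t ^ 2 + Q t ^ 2) 0 t := by
      simp only [hPQ]
      exact hasDerivAt_const t 1
    have h3 := h1.unique h2
    push_cast at h3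
    linarith
  have hPk : ∀ t, HasDerivAt P (-Q t * k t) t := fun t => by
    refine (hPd t).congr_deriv ?_
    simp only [hk]
    linear_combination P t * hPQ' t - Q t * hcurv t - deriv P t * hPQ t
  have hQk : ∀ t, HasDerivAt Q (P t * k t) t := fun t => by
    refine (hQdiff t).congr_deriv ?_
    simp only [hk]
    linear_combination Q t * hPQ' t + P t * hcurv t - deriv Q t * hPQ t
  obtain ⟨J, hJ⟩ : ∃ J, ∀ t, Q t * sn κ (r t) = J + 2 * H * vs κ (r t) := by
    refine ⟨Q 0 * sn κ (r 0) - 2 * H * vs κ (r 0), fun t => ?_⟩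
    have hI : ∀ t, HasDerivAt (fun t => Q t * sn κ (r t) - 2 * H * vs κ (r t)) 0 t := fun t => by
      refine (((hQk t).mul ((hasDerivAt_sn κ (r t)).comp t (hrd t))).sub
        (((hasDerivAt_vs κ (r t)).comp t (hrd t)).const_mul (2 * H))).congr_deriv ?_
      have h2 := (hsn t).ne'
      simp only [hk, Function.comp_apply]
      field_simp
      ring
    linarith [eq_of_hasDerivAt_zero hI t 0]
  have hrT : Function.Periodic r T := fun t => by simp only [hr, hper t]
  have hhT : Function.Periodic h T := fun t => by simp only [hh, hper t]
  have hh0T : h T = h 0 := by simpa using hhT 0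
  have hJmem : J ∈ nodoidal κ H := by
    by_contra hJn
    -- For J ≥ 0 the first integral gives Q sn > 0. If J < 0 and 4H + κJ ≤ 0, then κ > 0, and κ vs <
    -- 2 gives Q sn < 0.
    have hsign : (∀ t, 0 < Q t) ∨ ∀ t, Q t < 0 := by
      rcases le_or_gt 0 J with h0 | h0
      · refine Or.inl fun t => ?_
        have h1 := mul_pos hH (vs_pos (hrm t))
        have h2 : 0 < Q t * sn κ (r t) := by rw [hJ]; linarith
        exact (mul_pos_iff_of_pos_right (hsn t)).1 h2
      · refine Or.inr fun t => ?_
        have h1 : 4 * H + κ * J ≤ 0 := not_lt.1 fun h1 => hJn ⟨h0, h1⟩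
        have hκ : 0 < κ := by
          by_contra hκ
          have := mul_nonneg_of_nonpos_of_nonpos (not_lt.1 hκ) h0.le
          linarith
        have h2 : κ * (J + 2 * H * vs κ (r t)) < 0 := by
          have := mul_lt_mul_of_pos_left (mul_vs_lt_two (hrm t)) hH
          linarith
        rw [← hJ] at h2
        have h3 : Q t * sn κ (r t) < 0 := lt_of_mul_lt_mul_left (by rwa [mul_zero]) hκ.le
        exact lt_of_mul_lt_mul_right (by rwa [zero_mul]) (hsn t).le
    rcases hsign with hs | hs
    · have : StrictMono h := strictMono_of_deriv_pos fun t => by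
        rw [(hhd' t).deriv]
        exact div_pos (mul_pos (hρ' t) (hs t)) (hsn t)
      exact (this hT).ne' hh0T
    · have : StrictAnti h := strictAnti_of_deriv_neg fun t => by
        rw [(hhd' t).deriv]
        exact div_neg_of_neg_of_pos (mul_neg_of_pos_of_neg (hρ' t) (hs t)) (hsn t)
      exact (this hT).ne hh0T
  have hQ1 : ∀ t, Q t ^ 2 ≤ 1 := fun t => by nlinarith [hPQ t, sq_nonneg (P t)]
  have hkt : ∀ t, k t * sn κ (r t) = turn κ H J (Q t) ∧ vs κ (r t) = vsOf κ H J (Q t) := by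
    intro t
    have h1 := eq_turn_and_eq_vsOf hH hω hJmem (hQ1 t) (hsn t) (vs_pos (hrm t))
      (mul_vs_lt_two (hrm t)) (sn_sq κ (r t)) (hJ t)
    refine ⟨?_, h1.2⟩
    rw [← h1.1, ← cs_half]
    have h2 := (hsn t).ne'
    simp only [hk]
    field_simp
  have hkpos : ∀ t, 0 < k t := fun t =>
    (mul_pos_iff_of_pos_right (hsn t)).1 ((hkt t).1 ▸ turn_pos (Q t) hJmem)
  have hkc : Continuous k := continuous_iff_continuousAt.2 fun t =>
    (continuousAt_const.sub (((hQdiff t).mul ((hasDerivAt_cs κ (r t)).comp t (hrd t))).div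
      ((hasDerivAt_sn κ (r t)).comp t (hrd t)) (hsn t).ne').continuousAt)
  obtain ⟨σ, hσ, hPQσ⟩ := exists_angle hkc hPk hQk hPQ
  have hσm : StrictMono σ := strictMono_of_deriv_pos fun t => by rw [(hσ t).deriv]; exact hkpos t
  have hdiff0 : ∀ t, HasDerivAt (fun t => h t - height κ τ a H J (σ t)) 0 t := fun t => by
    refine ((hhd' t).sub ((hasDerivAt_height hH hω hJmem (σ t)).comp t (hσ t))).congr_deriv ?_
    rw [heightRate, ← (hPQσ t).2, ← (hkt t).1, ← (hkt t).2]
    have h1 := (hsn t).ne'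
    have h2 := (hkpos t).ne'
    field_simp
    ring
  have hheight : height κ τ a H J (σ T) = height κ τ a H J (σ 0) := by
    linarith [eq_of_hasDerivAt_zero hdiff0 T 0]
  have hPT : P T = P 0 := by simpa using periodic_deriv hrT 0
  have hQT : Q T = Q 0 := by
    have h1 : deriv h T = deriv h 0 := by simpa using periodic_deriv hhT 0
    have h2 : r T = r 0 := by simpa using hrT 0
    simp only [hQ, h1, h2]
  have hang : ((σ T : ℝ) : Real.Angle) = σ 0 := by
    refine Real.Angle.cos_sin_inj ?_ ?_
    · rw [← (hPQσ T).1, ← (hPQσ 0).1, hPT]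
    · rw [← (hPQσ T).2, ← (hPQσ 0).2, hQT]
  obtain ⟨n, hn⟩ := Real.Angle.angle_eq_iff_two_pi_dvd_sub.1 hang
  have hn0 : 0 < n := by
    have h1 := hσm hT
    have h2 : 0 < 2 * Real.pi * (n : ℝ) := by linarith
    exact_mod_cast (mul_pos_iff_of_pos_left (by positivity)).1 h2
  lift n to ℕ using hn0.le
  have h1 := height_add_nat_mul (τ := τ) (a := a) hH hω hJmem n (σ 0)
  rw [show σ 0 + n * (2 * Real.pi) = σ T by push_cast at hn; linarith, hheight] at h1
  refine ⟨J, hJmem, ?_⟩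
  have h2 : (n : ℝ) * drift κ τ a H J = 0 := by linarith
  exact (mul_eq_zero.1 h2).resolve_left (by exact_mod_cast hn0.ne')

end ScrewCMC

end

/-! ### Translating the parameter conditions -/

theorem theorem3p5 (κ τ a ε : ℝ) (hne : κ - 4 * τ ^ 2 ≠ 0)
    (hε : ε = Real.sign (κ - 4 * τ ^ 2)) :
    (∀ H : ℝ, 0 < H → 0 < 4 * H ^ 2 + κ →
      ((κ ≤ 0 ∧ a * τ * ε ∈ Set.Iio (ε / 2) ∧
          H ^ 2 > (2 * τ ^ 2 - a * τ * κ) / (4 * a * τ - 2)) ∨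
        (0 < κ ∧ a * τ * ε ∈ Set.Ico (2 * τ ^ 2 * ε / κ) (ε / 2) ∧
          H ^ 2 > (2 * τ ^ 2 - a * τ * κ) / (4 * a * τ - 2)) ∨
        (0 < κ ∧ a * τ * ε ∈ Set.Ioc (4 * τ ^ 2 * ε / κ - ε / 2) (2 * τ ^ 2 * ε / κ) ∧
          H ^ 2 > (2 * τ ^ 2 - a * τ * κ) / (4 * a * τ + 2 - 16 * τ ^ 2 / κ))) →
      ScrewCMC.ContainsTube κ τ a H) ∧
    (¬ ((κ ≤ 0 ∧ a * τ * ε ∈ Set.Iio (ε / 2)) ∨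
        (0 < κ ∧ a * τ * ε ∈ Set.Ico (2 * τ ^ 2 * ε / κ) (ε / 2)) ∨
        (0 < κ ∧ a * τ * ε ∈ Set.Ioc (4 * τ ^ 2 * ε / κ - ε / 2) (2 * τ ^ 2 * ε / κ))) →
      ∀ H : ℝ, 0 < H → 0 < 4 * H ^ 2 + κ → ¬ ScrewCMC.ContainsTube κ τ a H) := by
  -- The threshold for the midpoints. With d = |κ - 4τ²|, the interval endpoints ε/2, 2τ²ε/κ and
  -- 4τ²ε/κ - ε/2 for aτε correspond to c = 0, 1/κ and 2/κ.
  obtain ⟨c, hc⟩ : ∃ c, (κ - 4 * τ ^ 2) * c = 1 - 2 * a * τ :=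
    ⟨(1 - 2 * a * τ) / (κ - 4 * τ ^ 2), mul_div_cancel₀ _ hne⟩
  obtain ⟨d, hd, hdε⟩ : ∃ d > 0, κ - 4 * τ ^ 2 = d * ε ∧ ε ^ 2 = 1 := by
    rcases lt_or_gt_of_ne hne with h | h
    · exact ⟨-(κ - 4 * τ ^ 2), by linarith, by rw [hε, Real.sign_of_neg h]; ring,
        by rw [hε, Real.sign_of_neg h]; ring⟩
    · exact ⟨κ - 4 * τ ^ 2, h, by rw [hε, Real.sign_of_pos h]; ring,
        by rw [hε, Real.sign_of_pos h]; ring⟩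
  obtain ⟨hdε, hε2⟩ := hdε
  have hdc : ε / 2 - a * τ * ε = d * c / 2 := by
    linear_combination (-ε / 2) * hc + ε * c / 2 * hdε + d * c / 2 * hε2
  have hlow : 0 < κ → a * τ * ε - (4 * τ ^ 2 * ε / κ - ε / 2) = d * (2 / κ - c) / 2 := by
    intro hκ
    field_simp
    linear_combination (κ * ε) * hc - (κ * ε * c - 2 * ε) * hdε - (κ * d * c - 2 * d) * hε2
  have hmid : 0 < κ → a * τ * ε - 2 * τ ^ 2 * ε / κ = d * (1 / κ - c) / 2 := by
    intro hκ
    field_simp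
    linear_combination (κ * ε) * hc - (κ * ε * c - ε) * hdε - (κ * d * c - d) * hε2
  constructor
  · intro H hH hω hcase
    -- The bound on H in cases 1 and 2 says exactly 1/c < 4H² + κ, the hypothesis of
    -- `exists_mid_lt`.
    have hup : 0 < c → H ^ 2 > (2 * τ ^ 2 - a * τ * κ) / (4 * a * τ - 2) →
        1 < c * (4 * H ^ 2 + κ) := by
      intro hc0 hb
      have h1 : (2 * τ ^ 2 - a * τ * κ) / (4 * a * τ - 2) = (1 / c - κ) / 4 := by
        have h2 : 4 * a * τ - 2 = -2 * ((κ - 4 * τ ^ 2) * c) := by linear_combination 2 * hc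
        rw [h2, div_eq_div_iff (mul_ne_zero (by norm_num) (mul_ne_zero hne hc0.ne')) (by norm_num)]
        have h3 : 1 / c * c = 1 := one_div_mul_cancel hc0.ne'
        linear_combination 2 * (κ - 4 * τ ^ 2) * h3 - 2 * κ * hc
      rw [h1] at hb
      have h2 : 1 / c < 4 * H ^ 2 + κ := by linarith
      rwa [div_lt_iff₀' hc0] at h2
    suffices h : ∃ J ∈ ScrewCMC.nodoidal κ H, ScrewCMC.drift κ τ a H J = 0 by
      obtain ⟨J, hJ, h⟩ := h
      exact ScrewCMC.containsTube_of_drift_eq_zero hH hω hJ h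
    have hrefl : 0 < κ → 1 < (2 / κ - c) * (4 * H ^ 2 + κ) →
        ∃ J ∈ ScrewCMC.nodoidal κ H, ∀ q, 0 < q → q ≤ 1 → c < ScrewCMC.mid κ H J q := by
      intro hκ h
      obtain ⟨J, hJ, h⟩ := ScrewCMC.exists_mid_lt hH hω h
      refine ⟨_, ScrewCMC.reflect_mem_nodoidal hκ hJ, fun q h0 h1 => ?_⟩
      rw [ScrewCMC.mid_reflect hκ hH]
      linarith [h q h0 h1]
    -- Since κ < 4H² + κ, one of the two bounds is automatic: the one for 2/κ - c when c ≤ 1/κ, the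
    -- one for c when c ≥ 1/κ.
    have hmidpoint : ∀ {e : ℝ}, 0 < κ → 1 / κ ≤ e → 1 < e * (4 * H ^ 2 + κ) := by
      intro e hκ he
      refine lt_of_lt_of_le ?_ (mul_le_mul_of_nonneg_right he hω.le)
      rw [one_div_mul_eq_div, one_lt_div hκ]
      linarith [pow_pos hH 2]
    rcases hcase with ⟨hκ, h1, h2⟩ | ⟨hκ, ⟨h1, h1'⟩, h2⟩ | ⟨hκ, ⟨h1, h1'⟩, h2⟩
    · have hc0 : 0 < c := by
        have : 0 < d * c := by linarith [Set.mem_Iio.1 h1]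
        exact (mul_pos_iff_of_pos_left hd).1 this
      exact ScrewCMC.exists_drift_eq_zero hH hω hne hc (ScrewCMC.exists_mid_lt hH hω (hup hc0 h2))
        (ScrewCMC.exists_lt_mid hH hκ hω hc0)
    · have hc0 : 0 < c := by
        have : 0 < d * c := by linarith
        exact (mul_pos_iff_of_pos_left hd).1 this
      have hc1 : 0 ≤ 1 / κ - c := by
        have : 0 ≤ d * (1 / κ - c) := by linarith [hmid hκ]
        exact nonneg_of_mul_nonneg_right this hd
      refine ScrewCMC.exists_drift_eq_zero hH hω hne hc
        (ScrewCMC.exists_mid_lt hH hω (hup hc0 h2)) (hrefl hκ (hmidpoint hκ ?_))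
      linarith [show 2 / κ = 1 / κ + 1 / κ by ring]
    · have hc0 : 0 < 2 / κ - c := by
        have : 0 < d * (2 / κ - c) := by linarith [hlow hκ]
        exact (mul_pos_iff_of_pos_left hd).1 this
      have hc1 : 1 / κ ≤ c := by
        have : 0 ≤ d * (c - 1 / κ) := by linarith [hmid hκ]
        linarith [nonneg_of_mul_nonneg_right this hd]
      refine ScrewCMC.exists_drift_eq_zero hH hω hne hc
        (ScrewCMC.exists_mid_lt hH hω (hmidpoint hκ hc1)) (hrefl hκ ?_)
      -- The bound in case 3 is that of case 2 with c replaced by its reflection 2/κ - c.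
      have h3 : (2 * τ ^ 2 - a * τ * κ) / (4 * a * τ + 2 - 16 * τ ^ 2 / κ) =
          (1 / (2 / κ - c) - κ) / 4 := by
        have h4 : 2 / κ * κ = 2 := div_mul_cancel₀ _ hκ.ne'
        have h5 : 4 * a * τ + 2 - 16 * τ ^ 2 / κ = 2 * ((κ - 4 * τ ^ 2) * (2 / κ - c)) := by
          linear_combination -2 * h4 + 2 * hc
        have h6 : 1 / (2 / κ - c) * (2 / κ - c) = 1 := one_div_mul_cancel hc0.ne'
        rw [h5, div_eq_div_iff (mul_ne_zero two_ne_zero (mul_ne_zero hne hc0.ne')) (by norm_num)]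
        linear_combination -2 * (κ - 4 * τ ^ 2) * h6 + 2 * (κ - 4 * τ ^ 2) * h4 - 2 * κ * hc
      rw [h3] at h2
      have h7 : 1 / (2 / κ - c) < 4 * H ^ 2 + κ := by linarith
      rwa [div_lt_iff₀' hc0] at h7
  · intro hcase H hH hω htube
    obtain ⟨J, hJ, hdr⟩ := ScrewCMC.exists_drift_eq_zero_of_containsTube hH hω htube
    refine ScrewCMC.drift_ne_zero hH hω hJ hne hc ?_ hdr
    by_contra! hcon
    obtain ⟨hc0, hc1⟩ := hcon
    have hdc0 := mul_pos hd hc0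
    rcases le_or_gt κ 0 with hκ | hκ
    · exact hcase (Or.inl ⟨hκ, Set.mem_Iio.2 (by linarith)⟩)
    · have h1 := mul_pos hd (sub_pos.2 (hc1 hκ))
      rcases le_total (2 * τ ^ 2 * ε / κ) (a * τ * ε) with h | h
      · exact hcase (Or.inr (Or.inl ⟨hκ, h, by linarith⟩))
      · exact hcase (Or.inr (Or.inr ⟨hκ, by linarith [hlow hκ], h⟩))
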